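/- Let $F=\bigoplus_{i\in I}F^i$ and $E=\bigoplus_{p\in P}E^p$ be finite-dimensional C*-algebras, written as finite direct sums of full matrix algebras $F^i=M_{d_i}(\mathbb C)$, $E^p=M_{n_p}(\mathbb C)$, and let $DE\subseteq E$ be the subalgebra of diagonal matrices. Let $\beta_0,\beta_1\colon F\to E$ be (not necessarily unital) *-homomorphisms such that: (A1) for all $i\in I$, $p\in P$ and $\mathfrak r\in\{0,1\}$, the component $\beta_{\mathfrak r}^{p,i}\colon F^i\to E^p$ of $\beta_{\mathfrak r}$ is a composition $F^i\to M_m\otimes F^i\to E^p$, where $m=m_{\mathfrak r}(p,i)\ge 0$ is an integer, the first map is $x\mapsto 1\otimes x$, and the second is a *-homomorphism of multiplicity one (it preserves ranks of projections) which sends diagonal matrices to diagonal matrices; (A2) $(\beta_0,\beta_1)\colon F\to E\oplus E$ is injective. Let $A=A(E,F,\beta_0,\beta_1)=\{(f,a)\in C([0,1],E)\oplus F : f(0)=\beta_0(a),\ f(1)=\beta_1(a)\}$ be the corresponding 1-dimensional NCCW complex. For a permutation matrix $\sigma\in E$ (each component $\sigma^p\in E^p$ is a permutation matrix) put $$A_\sigma=A(E,F,\beta_0,\mathrm{Ad}(\sigma)\circ\beta_1)=\{(f,a)\in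 C([0,1],E)\oplus F : f(0)=\beta_0(a),\ f(1)=\sigma\beta_1(a)\sigma^*\},$$ $$B_\sigma=\{(f,a)\in A_\sigma : f(t)\in DE \text{ for all } t\in[0,1]\}.$$ A C*-diagonal of a C*-algebra $A$ is a maximal abelian C*-subalgebra $B\subseteq A$ which contains an approximate unit of $A$, whose normalizers $\{n\in A : nBn^*\subseteq B,\ n^*Bn\subseteq B\}$ generate $A$ as a C*-algebra, onto which there is a faithful conditional expectation $A\to B$, and which has the unique extension property: every pure state of $B$ has exactly one extension to a state of $A$. Then for every C*-diagonal $B$ of $A$ there exists a permutation matrix $\sigma\in E$ such that $(A,B)\cong(A_\sigma,B_\sigma)$, i.e. there is a *-isomorphism $A\to A_\sigma$ sending $B$ onto $B_\sigma$. -/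

import Mathlib

open scoped Matrix.Norms.L2Operator ComplexOrder Kronecker

noncomputable section

/-! ## C*-diagonals -/

section CStarDiagonal

variable {A : Type*} [NonUnitalNormedRing A] [StarRing A] [NormedSpace ℂ A]

/-- The states of a (not necessarily unital) C*-algebra: positive functionals of norm one. -/
def cstarStates (A : Type*) [NonUnitalNormedRing A] [StarRing A] [NormedSpace ℂ A] :
    Set (A →L[ℂ] ℂ) :=
  {φ | (∀ a : A, 0 ≤ φ (star a * a)) ∧ ‖φ‖ = 1}

/-- The pure states: the extreme points of the convex set of states. -/
def cstarPureStates (A : Type*) [NonUnitalNormedRing A] [StarRing A] [NormedSpace ℂ A] :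
    Set (A →L[ℂ] ℂ) :=
  (cstarStates A).extremePoints ℝ

/-- The normalizers of `B` in `A`: the `n` with `n B n* ⊆ B` and `n* B n ⊆ B`. -/
def cstarNormalizers (B : NonUnitalStarSubalgebra ℂ A) : Set A :=
  {n | ∀ b ∈ B, n * b * star n ∈ B ∧ star n * b * n ∈ B}

/-- `P` is a faithful conditional expectation of `A` onto `B`: a contractive positive
`B`-bimodular projection with range `B` such that `P (a* a) = 0` only for `a = 0`. -/
structure IsFaithfulCondExp (B : NonUnitalStarSubalgebra ℂ A) (P : A →L[ℂ] A) : Prop where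
  map_mem : ∀ a, P a ∈ B
  map_of_mem : ∀ b ∈ B, P b = b
  contractive : ∀ a, ‖P a‖ ≤ ‖a‖
  positive : ∀ a, ∃ b ∈ B, P (star a * a) = star b * b
  map_mul_left : ∀ b ∈ B, ∀ a, P (b * a) = b * P a
  map_mul_right : ∀ b ∈ B, ∀ a, P (a * b) = P a * b
  faithful : ∀ a, P (star a * a) = 0 → a = 0

end CStarDiagonal

/-- `B` is a C*-diagonal of the C*-algebra `A`: a Cartan subalgebra of `A` (a maximal abelian
C*-subalgebra which contains an approximate unit of `A`, whose normalizers generate `A`, and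
onto which there is a faithful conditional expectation) with the unique extension property
(every pure state of `B` has exactly one extension to a state of `A`). -/
structure IsCStarDiagonal {A : Type*} [NonUnitalCStarAlgebra A]
    (B : NonUnitalStarSubalgebra ℂ A) : Prop where
  isClosed : IsClosed (B : Set A)
  commutative : ∀ a ∈ B, ∀ b ∈ B, a * b = b * a
  maximal : ∀ a : A, (∀ b ∈ B, a * b = b * a) → a ∈ B
  approximateUnit : ∃ l : Filter A, l.IsApproximateUnit ∧ (B : Set A) ∈ l
  regular : Dense (NonUnitalStarAlgebra.adjoin ℂ (cstarNormalizers B) : Set A)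
  condExp : ∃ P : A →L[ℂ] A, IsFaithfulCondExp B P
  uniqueExtension : ∀ φ ∈ cstarPureStates B,
    ∃! ψ : A →L[ℂ] ℂ, ψ ∈ cstarStates A ∧ ∀ b : B, ψ (b : A) = φ b

/-! ## One-dimensional NCCW complexes -/

/-- The finite-dimensional C*-algebra `⨁ k, M_{n k}(ℂ)`, with the C*-norm. -/
abbrev MatSum {K : Type*} (n : K → ℕ) : Type _ :=
  ∀ k, Matrix (Fin (n k)) (Fin (n k)) ℂ

section NCCW

variable {I P : Type*} [Fintype I] [Fintype P] {d : I → ℕ} {n : P → ℕ}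

/-- A *-homomorphism between matrix algebras is of multiplicity one and diagonal if it preserves
the ranks of projections and sends diagonal matrices to diagonal matrices. -/
def IsDiagMultOne {X Y : Type*} [Fintype X] [DecidableEq X] [Fintype Y] [DecidableEq Y]
    (ι : Matrix X X ℂ →⋆ₙₐ[ℂ] Matrix Y Y ℂ) : Prop :=
  (∀ e : Matrix X X ℂ, IsStarProjection e → (ι e).rank = e.rank) ∧
    ∀ x : Matrix X X ℂ, x.IsDiag → (ι x).IsDiag

/-- Every component `F^i → E^p` of `β` is of the form `x ↦ ι (1 ⊗ x)`, where `1` is the unit of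
a matrix algebra `M_m` (`m = m(p, i) ≥ 0`), and `ι : M_m ⊗ F^i → E^p` is of multiplicity one and
sends diagonal matrices to diagonal matrices. -/
def IsStandardHom [DecidableEq I] (β : MatSum d →⋆ₙₐ[ℂ] MatSum n) : Prop :=
  ∀ (p : P) (i : I), ∃ (m : ℕ)
    (ι : Matrix (Fin m × Fin (d i)) (Fin m × Fin (d i)) ℂ →⋆ₙₐ[ℂ]
      Matrix (Fin (n p)) (Fin (n p)) ℂ),
    IsDiagMultOne ι ∧
      ∀ x : Matrix (Fin (d i)) (Fin (d i)) ℂ,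
        β (Pi.single i x) p = ι ((1 : Matrix (Fin m) (Fin m) ℂ) ⊗ₖ x)

/-- The 1-dimensional NCCW complex
`A(E, F, β₀, β₁) = {(f, a) ∈ C([0,1], E) ⊕ F | f(0) = β₀(a), f(1) = β₁(a)}`. -/
def nccw (β₀ β₁ : MatSum d →⋆ₙₐ[ℂ] MatSum n) :
    NonUnitalStarSubalgebra ℂ (C(unitInterval, MatSum n) × MatSum d) where
  carrier := {x | x.1 0 = β₀ x.2 ∧ x.1 1 = β₁ x.2}
  add_mem' := by
    rintro x y ⟨h₁, h₂⟩ ⟨h₃, h₄⟩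
    simp [h₁, h₂, h₃, h₄]
  zero_mem' := by simp
  mul_mem' := by
    rintro x y ⟨h₁, h₂⟩ ⟨h₃, h₄⟩
    simp [h₁, h₂, h₃, h₄]
  smul_mem' := by
    rintro c x ⟨h₁, h₂⟩
    simp [h₁, h₂]
  star_mem' := by
    rintro x ⟨h₁, h₂⟩
    simp [h₁, h₂, map_star]

/-- The NCCW complex is a closed subalgebra, hence a C*-algebra. -/
instance isClosed_nccw (β₀ β₁ : MatSum d →⋆ₙₐ[ℂ] MatSum n) :
    IsClosed (nccw β₀ β₁ : Set (C(unitInterval, MatSum n) × MatSum d)) := by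
  have c₀ : Continuous β₀ :=
    LinearMap.continuous_of_finiteDimensional (β₀ : MatSum d →ₗ[ℂ] MatSum n)
  have c₁ : Continuous β₁ :=
    LinearMap.continuous_of_finiteDimensional (β₁ : MatSum d →ₗ[ℂ] MatSum n)
  refine IsClosed.inter (isClosed_eq ?_ ?_) (isClosed_eq ?_ ?_) <;> fun_prop

/-- The pointwise diagonal elements of the NCCW complex:
`{(f, a) ∈ A(E, F, β₀, β₁) | f(t) ∈ DE for all t ∈ [0,1]}`. -/
def nccwDiag (β₀ β₁ : MatSum d →⋆ₙₐ[ℂ] MatSum n) :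
    NonUnitalStarSubalgebra ℂ (nccw β₀ β₁) where
  carrier := {x | ∀ (t : unitInterval) (p : P), (x.1.1 t p).IsDiag}
  add_mem' := fun hx hy t p => (hx t p).add (hy t p)
  zero_mem' := fun _ _ => Matrix.isDiag_zero
  mul_mem' := fun {x y} hx hy t p => by
    have h : (x.1.1 t p * y.1.1 t p).IsDiag := by
      rw [← (hx t p).diagonal_diag, ← (hy t p).diagonal_diag, Matrix.diagonal_mul_diagonal]
      exact Matrix.isDiag_diagonal _
    exact h
  smul_mem' := fun c _ hx t p => (hx t p).smul c
  star_mem' := fun hx t p => (hx t p).conjTranspose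

/-- `σ` is a permutation matrix in `E`: each component `σ^p ∈ E^p` is a permutation matrix. -/
def IsPermMatrix (σ : MatSum n) : Prop :=
  ∀ p, ∃ π : Equiv.Perm (Fin (n p)), σ p = π.permMatrix ℂ

/-- `Ad(σ) ∘ β : a ↦ σ β(a) σ*` for a unitary `σ ∈ E`. -/
def adComp (σ : unitary (MatSum n)) (β : MatSum d →⋆ₙₐ[ℂ] MatSum n) :
    MatSum d →⋆ₙₐ[ℂ] MatSum n :=
  (Unitary.conjStarAlgAut ℂ (MatSum n) σ : MatSum n →⋆ₙₐ[ℂ] MatSum n).comp β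

end NCCW

end

/-! Evaluation at a point of `(0,1)` and the projection to `F` map `A` onto finite-dimensional
algebras. The image of `B` is commutative, so a unitary diagonalizes it, and it is then the full
diagonal: diagonal entries are multiplicative on `B`, hence restrict to pure states, and two entries
agreeing on `B` would violate unique extension (`IsCStarDiagonal.exists_eq_diagonal`). Two unitaries
diagonalizing `B` at the same point differ by one that normalizes the diagonal matrices, and this
quotient may be applied at every other point as well. Hence local continuous choices glue to a path
`u` on the open interval (`IsCStarDiagonal.exists_continuousOn_Ioo_diagonalizes`). Let `w` be a
diagonalizing unitary in `F`.

The difficulty lies at the end points, where `u` need not converge. Normalizers of `B` become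
monomial matrices after conjugation by `u t`, and they lift the matrix units of `F` relative to `w`.
So each cluster point of `u` at `0` conjugates `β₀ ∘ Ad(w*)` to a monomial representation of `F`; by
(A1), `β₀` is monomial too. A monomial representation is determined by its multiplicities up to a
permutation and phases. The entries of the limits of the lifted matrix units have modulus `0` or
`1`, so by connectedness the support cannot oscillate as `t → 0`: one permutation and a continuous
path of diagonal unitaries correct `u` to `V` with `V β₀(a) V* → β₀(w a w*)`
(`exists_perm_phases_tendsto`).

The end point `1` is treated alike, with a second permutation; the quotient of the two is `σ`.
Conjugation by `V` and `w` is then an isomorphism `A → A_σ` carrying `B` into `B_σ`. By (A2) `B_σ`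
is commutative, so maximality of `B` makes the image all of `B_σ`. -/

set_option linter.unusedSectionVars false

/-! ### Simultaneous diagonalization -/

/-- A commuting family of Hermitian matrices is simultaneously unitarily diagonalizable. -/
theorem Matrix.exists_unitary_isDiag_of_pairwise_commute {X ι : Type*} [Fintype X] [DecidableEq X]
    (T : ι → Matrix X X ℂ) (hT : ∀ i, (T i).IsHermitian) (hC : ∀ i j, T i * T j = T j * T i) :
    ∃ w ∈ unitary (Matrix X X ℂ), ∀ i, (w * T i * star w).IsDiag := by
  classical
  obtain ⟨L, hLdef⟩ : ∃ L : ι → Module.End ℂ (EuclideanSpace ℂ X),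
      ∀ i, L i = Matrix.toEuclideanLin (T i) := ⟨_, fun _ => rfl⟩
  have hL : ∀ i, (L i).IsSymmetric := fun i => by
    rw [hLdef]; exact Matrix.isSymmetric_toEuclideanLin_iff.2 (hT i)
  have hLC : Pairwise (Function.onFun Commute L) := by
    intro i j _
    have h := hC i j
    change L i * L j = L j * L i
    ext v : 1
    simp only [hLdef, Module.End.mul_apply, Matrix.toLpLin_apply, Matrix.mulVec_mulVec, h]
  have hint := DirectSum.isInternal_ne_bot_iff.mpr
    (LinearMap.IsSymmetric.directSum_isInternal_of_pairwise_commute hL hLC)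
  set V : (ι → ℂ) → Submodule ℂ (EuclideanSpace ℂ X) :=
    fun α => ⨅ j, (L j).eigenspace (α j) with hV
  have hfam : OrthogonalFamily ℂ (fun α => V α) (fun α => (V α).subtypeₗᵢ) :=
    LinearMap.IsSymmetric.orthogonalFamily_iInf_eigenspaces hL
  have hind := hfam.independent
  have hfin : Finite {α : ι → ℂ // V α ≠ ⊥} :=
    (WellFoundedGT.finite_ne_bot_of_iSupIndep hind).to_subtype
  have : Fintype {α : ι → ℂ // V α ≠ ⊥} := Fintype.ofFinite _
  have hfam' : OrthogonalFamily ℂ (fun α : {α : ι → ℂ // V α ≠ ⊥} => V α)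
      (fun α => (V α).subtypeₗᵢ) := hfam.comp Subtype.val_injective
  let e := hint.subordinateOrthonormalBasis (n := Fintype.card X) (by simp) hfam'
  let b : OrthonormalBasis X ℂ (EuclideanSpace ℂ X) := e.reindex (Fintype.equivFin X).symm
  have hb : ∀ x i, ∃ μ : ℂ, L i (b x) = μ • b x := by
    intro x i
    have := hint.subordinateOrthonormalBasis_subordinate (by simp) (Fintype.equivFin X x) hfam'
    have h2 := (Submodule.mem_iInf _).1 this i
    obtain ⟨μ, hμ⟩ : ∃ μ, b x ∈ Module.End.eigenspace (L i) μ := ⟨_, by simpa [b, e] using h2⟩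
    exact ⟨μ, Module.End.mem_eigenspace_iff.1 hμ⟩
  let W : Matrix X X ℂ := Matrix.of fun a x => b x a
  have hdot : ∀ x y, ∑ a, star (b x a) * b y a = if x = y then 1 else 0 := by
    intro x y
    have := orthonormal_iff_ite.1 b.orthonormal x y
    rw [← this]
    simp [PiLp.inner_apply, mul_comm]
  have hWW : star W * W = 1 := by
    ext x y
    simp only [Matrix.mul_apply, Matrix.star_apply, W, Matrix.of_apply, hdot, Matrix.one_apply]
  have hWW' : W * star W = 1 := mul_eq_one_comm.1 hWW
  refine ⟨star W, ⟨by simpa using hWW', by simpa using hWW⟩, fun i x y hxy => ?_⟩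
  obtain ⟨μ, hμ⟩ := hb y i
  have h1 : ∀ a, (T i * W) a y = μ * W a y := by
    intro a
    have := congrArg (fun v : EuclideanSpace ℂ X => v a) hμ
    simpa [hLdef, Matrix.toLpLin_apply, Matrix.mulVec, dotProduct, Matrix.mul_apply, W] using this
  rw [star_star, Matrix.mul_assoc, Matrix.mul_apply]
  simp only [h1, Matrix.star_apply, W, Matrix.of_apply]
  have : ∑ a, star (b x a) * (μ * b y a) = μ * ∑ a, star (b x a) * b y a := by
    rw [Finset.mul_sum]; refine Finset.sum_congr rfl fun _ _ => by ring
  rw [this, hdot, if_neg hxy, mul_zero]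

/-! ### Positive functionals and pure states -/

section States

variable {C : Type*} [NonUnitalNormedRing C] [StarRing C] [NormedSpace ℂ C]
  [IsScalarTower ℂ C C] [SMulCommClass ℂ C C] [StarModule ℂ C]

/-- The degenerate case of the Cauchy–Schwarz inequality, from positivity on `e + μ • c` for all
scalars `μ`. -/
theorem map_star_mul_eq_zero_of_nonneg {ψ : C →L[ℂ] ℂ} (hψ : ∀ a, 0 ≤ ψ (star a * a)) {c : C}
    (hc : ψ (star c * c) = 0) (e : C) : ψ (star c * e) = 0 := by
  have key : ∀ μ : ℂ, 0 ≤ ψ (star e * e) + μ * ψ (star e * c) + star μ * ψ (star c * e) := by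
    intro μ
    have h := hψ (e + μ • c)
    have : star (e + μ • c) * (e + μ • c) = star e * e + μ • (star e * c)
        + star μ • (star c * e) + (star μ * μ) • (star c * c) := by
      simp only [star_add, star_smul, add_mul, mul_add, smul_mul_assoc, mul_smul_comm, smul_smul, smul_add]
      rw [mul_comm μ (star μ)]
      abel
    rw [this] at h
    simpa [hc] using h
  have h0 := (Complex.nonneg_iff.1 (hψ e)).2
  set z := ψ (star c * e)
  set z' := ψ (star e * c)
  set E := ψ (star e * e)
  have h1 := (Complex.nonneg_iff.1 (key 1)).2
  have h2 := (Complex.nonneg_iff.1 (key Complex.I)).2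
  -- The values `μ = 1` and `μ = I` give `z' = star z`; then `μ = -r z` with `r` large forces `z =
  -- 0`.
  have h3 : ∀ r : ℝ, 0 ≤ E.re - 2 * r * (z.re ^ 2 + z.im ^ 2) := by
    intro r
    have := (Complex.nonneg_iff.1 (key (-(r : ℂ) * z))).1
    simp at this h1 h2
    have e1 : z'.re = z.re := by linarith
    have e2 : z'.im = - z.im := by linarith
    rw [e1, e2] at this
    nlinarith
  have h4 : z.re ^ 2 + z.im ^ 2 = 0 := by
    by_contra hne
    have := h3 ((E.re + 1) / (2 * (z.re ^ 2 + z.im ^ 2)))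
    have h5 : 2 * ((E.re + 1) / (2 * (z.re ^ 2 + z.im ^ 2))) * (z.re ^ 2 + z.im ^ 2)
        = E.re + 1 := by field_simp
    rw [h5] at this
    linarith
  apply Complex.ext
  · simp; nlinarith [sq_nonneg z.re, sq_nonneg z.im]
  · simp; nlinarith [sq_nonneg z.re, sq_nonneg z.im]

/-- Multiplicative states of an algebra with an approximate unit are pure. -/
theorem mem_cstarPureStates_of_map_mul {φ : C →L[ℂ] ℂ} (hφ : ‖φ‖ = 1)
    (hmul : ∀ a b, φ (a * b) = φ a * φ b) (hstar : ∀ a, φ (star a) = star (φ a))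
    (happ : ∀ c : C, c ∈ closure (Set.range fun e => c * e)) : φ ∈ cstarPureStates C := by
  have hpos : ∀ a, 0 ≤ φ (star a * a) := fun a => by
    rw [hmul, hstar]; exact star_mul_self_nonneg _
  refine mem_extremePoints_iff_left.2 ⟨⟨hpos, hφ⟩, ?_⟩
  rintro ψ ⟨hψ, hψ1⟩ ψ' ⟨hψ', -⟩ ⟨s, t, hs, ht, -, hst⟩
  -- On positive elements `s • ψ ≤ φ`, so `ψ` kills `b * star b`; Cauchy–Schwarz and the approximate
  -- unit pass from there to `b`. Once the kernels are nested, `ψ` is a multiple of `φ`.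
  have hker : ∀ b, φ b = 0 → ψ b = 0 := by
    intro b hb
    have h1 : ψ (b * star b) = 0 := by
      have h2 : s • ψ (b * star b) + t • ψ' (b * star b) = 0 := by
        have := congrArg (fun f : C →L[ℂ] ℂ => f (b * star b)) hst
        simp only [hmul, hb, zero_mul] at this
        simpa using this
      have h3 : 0 ≤ ψ (b * star b) := by simpa using hψ (star b)
      have h4 : 0 ≤ ψ' (b * star b) := by simpa using hψ' (star b)
      have h5 : 0 ≤ s • ψ (b * star b) := smul_nonneg hs.le h3
      have h6 : 0 ≤ t • ψ' (b * star b) := smul_nonneg ht.le h4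
      have := ((add_eq_zero_iff_of_nonneg h5 h6).1 h2).1
      exact (smul_eq_zero.1 this).resolve_left hs.ne'
    have h2 : ∀ e, ψ (b * e) = 0 := fun e => by
      have := map_star_mul_eq_zero_of_nonneg hψ (c := star b) (by simpa using h1) e
      simpa using this
    have h3 : closure (Set.range fun e => b * e) ⊆ {x | ψ x = 0} :=
      closure_minimal (by rintro _ ⟨e, rfl⟩; exact h2 e) (isClosed_eq ψ.continuous continuous_const)
    exact h3 (happ b)
  obtain ⟨b, hb⟩ : ∃ b, φ b ≠ 0 := by
    by_contra! h
    have : φ = 0 := by ext x; simpa using h x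
    simp [this] at hφ
  have hb1 : φ ((φ b)⁻¹ • b) = 1 := by simp [hb]
  set b0 := (φ b)⁻¹ • b
  have h1 : ∀ a, ψ a = ψ b0 * φ a := by
    intro a
    have := hker (a - φ a • b0) (by simp [hb1])
    rw [map_sub, map_smul, sub_eq_zero, smul_eq_mul] at this
    rw [this, mul_comm]
  have h2 : ψ = ψ b0 • φ := by ext a; simp [h1 a]
  have h3 : 0 ≤ ψ b0 := by
    have := hψ b0
    rwa [h1, hmul, hstar, hb1, star_one, mul_one, mul_one] at this
  have h4 : ‖ψ b0‖ = 1 := by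
    have := congrArg norm h2
    rwa [norm_smul, hψ1, hφ, mul_one, eq_comm] at this
  have h5 : ψ b0 = 1 := by
    rw [Complex.nonneg_iff] at h3
    have h6 : ψ b0 = ((ψ b0).re : ℂ) := Complex.ext rfl (by simp [← h3.2])
    rw [h6, Complex.norm_real, Real.norm_of_nonneg h3.1] at h4
    rw [h6, h4, Complex.ofReal_one]
  rw [h2, h5, one_smul]

end States

/-! ### Diagonal entries of representations as functionals -/

theorem Matrix.norm_apply_le_l2_opNorm {X : Type*} [Fintype X] [DecidableEq X] (M : Matrix X X ℂ) (a b : X) :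
    ‖M a b‖ ≤ ‖M‖ := by
  have h := Matrix.l2_opNorm_mulVec M (EuclideanSpace.single b (1 : ℂ))
  have h2 := PiLp.norm_apply_le (WithLp.toLp 2 (M.mulVec (EuclideanSpace.single b (1 : ℂ)))) a
  have h3 : ‖EuclideanSpace.single b (1 : ℂ)‖ = 1 := by simp
  rw [h3, mul_one] at h
  refine le_trans (le_of_eq ?_) (h2.trans h)
  simp

section Diag

variable {K : Type*} [Fintype K] {d : K → ℕ}

theorem MatSum.norm_apply_le (M : MatSum d) (k : K) (a b : Fin (d k)) : ‖M k a b‖ ≤ ‖M‖ :=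
  (Matrix.norm_apply_le_l2_opNorm _ _ _).trans (norm_le_pi_norm M k)

variable {A : Type*} [NonUnitalCStarAlgebra A]

/-- The functional given by a diagonal entry of a representation. -/
noncomputable def diagFunctional (ρ : A →⋆ₙₐ[ℂ] MatSum d) (x : Σ k, Fin (d k)) : A →L[ℂ] ℂ :=
  LinearMap.mkContinuous
    { toFun := fun a => ρ a x.1 x.2 x.2
      map_add' := fun a b => by simp
      map_smul' := fun c a => by simp } 1
    fun a => by
      rw [one_mul]
      exact (MatSum.norm_apply_le _ _ _ _).trans (NonUnitalStarAlgHom.norm_apply_le ρ a)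

@[simp] theorem diagFunctional_apply (ρ : A →⋆ₙₐ[ℂ] MatSum d) (x : Σ k, Fin (d k)) (a : A) :
    diagFunctional ρ x a = ρ a x.1 x.2 x.2 := rfl

theorem diagFunctional_nonneg (ρ : A →⋆ₙₐ[ℂ] MatSum d) (x : Σ k, Fin (d k)) (a : A) :
    0 ≤ diagFunctional ρ x (star a * a) := by
  rw [diagFunctional_apply, map_mul, map_star, Pi.mul_apply, Pi.star_apply, Matrix.mul_apply]
  exact Finset.sum_nonneg fun i _ => star_mul_self_nonneg _

theorem norm_diagFunctional_le (ρ : A →⋆ₙₐ[ℂ] MatSum d) (x : Σ k, Fin (d k)) :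
    ‖diagFunctional ρ x‖ ≤ 1 :=
  LinearMap.mkContinuous_norm_le _ zero_le_one _

end Diag

/-! ### Functional calculus in a C*-diagonal -/

section CFC

variable {A : Type*} [NonUnitalCStarAlgebra A] {B : NonUnitalStarSubalgebra ℂ A}

/-- What commutes with `b` commutes with `cfcₙ g b`, so maximality of `B` suffices. -/
theorem IsCStarDiagonal.cfcₙ_mem (hB : IsCStarDiagonal B) {b : A} (hb : b ∈ B) (g : ℝ → ℝ) :
    cfcₙ g b ∈ B := by
  refine hB.maximal _ fun c hc => ?_
  exact (Commute.cfcₙ_real (hB.commutative b hb c hc) g)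

/-- The image of `B` is a finite-dimensional, hence closed, subspace, and it contains the images of
an approximate unit, which tend to `1`. The norm bound makes functionals with value `1` at the unit
of `R` have norm one, also after restriction to `B`. -/
theorem IsCStarDiagonal.exists_norm_le_one (hB : IsCStarDiagonal B) {R : Type*} [CStarAlgebra R]
    [FiniteDimensional ℂ R] (ρ : A →⋆ₙₐ[ℂ] R) (hρ : Function.Surjective ρ) :
    ∃ b ∈ B, ρ b = 1 ∧ ‖b‖ ≤ 1 := by
  have hc : Continuous ρ := by
    have := AddMonoidHomClass.continuous_of_bound ρ 1 (fun a => by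
      rw [one_mul]; exact NonUnitalStarAlgHom.norm_apply_le ρ a)
    exact this
  obtain ⟨a, ha⟩ := hρ 1
  obtain ⟨l, hl, hBl⟩ := hB.approximateUnit
  have hne := hl.neBot
  let S : Submodule ℂ R := B.toSubmodule.map (ρ : A →ₗ[ℂ] R)
  have h1 : (1 : R) ∈ S := by
    have hcl : IsClosed (S : Set R) := S.closed_of_finiteDimensional
    have ht : Filter.Tendsto (fun e => ρ (a * e)) l (nhds (ρ a)) :=
      (hc.tendsto _).comp (hl.tendsto_mul_left a)
    rw [ha] at ht
    refine hcl.mem_of_tendsto ht ?_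
    filter_upwards [hBl] with e he
    rw [map_mul, ha, one_mul]
    exact ⟨e, he, rfl⟩
  obtain ⟨b, hb, hb1⟩ := h1
  replace hb1 : ρ b = 1 := hb1
  replace hb : b ∈ B := hb
  let c : A := star b * b
  have hcB : c ∈ B := mul_mem (star_mem hb) hb
  have hcs : IsSelfAdjoint c := IsSelfAdjoint.star_mul_self b
  have hc1 : ρ c = 1 := by simp [c, hb1, map_star]
  -- Truncation to `[-1, 1]` bounds the norm and fixes `1`, so the image stays `1`.
  let g : ℝ → ℝ := fun s => max (-1) (min s 1)
  have hg : Continuous g := by fun_prop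
  have hg0 : g 0 = 0 := by simp [g]
  refine ⟨cfcₙ g c, hB.cfcₙ_mem hcB g, ?_, ?_⟩
  · rw [NonUnitalStarAlgHomClass.map_cfcₙ (S := ℂ) ρ g c hg.continuousOn hg0 hc hcs
      (by rw [hc1]; exact IsSelfAdjoint.one R), hc1, cfcₙ_eq_cfc hg.continuousOn hg0, cfc_apply_one]
    simp [g]
  · refine norm_cfcₙ_le fun x _ => ?_
    rw [Real.norm_eq_abs, abs_le]
    exact ⟨le_max_left _ _, max_le (by norm_num) (min_le_right _ _)⟩

end CFC

/-! ### Diagonalization of a C*-diagonal in a finite-dimensional quotient -/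

section Diag

variable {K : Type*} [Fintype K] {d : K → ℕ} {A : Type*} [NonUnitalCStarAlgebra A]
  {B : NonUnitalStarSubalgebra ℂ A}

theorem IsCStarDiagonal.mem_closure_mul (hB : IsCStarDiagonal B) (c : B) :
    c ∈ closure (Set.range fun e : B => c * e) := by
  obtain ⟨l, hl, hBl⟩ := hB.approximateUnit
  have hne := hl.neBot
  rw [Topology.IsInducing.subtypeVal.closure_eq_preimage_closure_image, Set.mem_preimage]
  refine mem_closure_of_tendsto (hl.tendsto_mul_left (c : A)) ?_
  filter_upwards [hBl] with e he
  exact ⟨c * ⟨e, he⟩, ⟨⟨e, he⟩, rfl⟩, rfl⟩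

theorem norm_eq_one_of_apply_eq_one {C : Type*} [NonUnitalNormedRing C] [NormedSpace ℂ C]
    (f : C →L[ℂ] ℂ) (hf : ‖f‖ ≤ 1) (b : C) (hb : ‖b‖ ≤ 1) (h : f b = 1) : ‖f‖ = 1 := by
  refine le_antisymm hf ?_
  have := f.le_opNorm b
  rw [h, norm_one] at this
  nlinarith [norm_nonneg f]

theorem MatSum.mul_apply_diag {x y : MatSum d} (hx : ∀ k, (x k).IsDiag) (k : K) (j : Fin (d k)) :
    (x * y) k j j = x k j j * y k j j := by
  rw [Pi.mul_apply, Matrix.mul_apply, Finset.sum_eq_single j]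
  · intro b _ hb
    rw [hx k hb.symm, zero_mul]
  · simp

/-- If a surjective representation maps a C*-diagonal to the diagonal matrices, then it maps it
onto the diagonal matrices. -/
theorem IsCStarDiagonal.exists_eq_diagonal (hB : IsCStarDiagonal B) (ρ : A →⋆ₙₐ[ℂ] MatSum d)
    (hρ : Function.Surjective ρ) (hD : ∀ b ∈ B, ∀ k, (ρ b k).IsDiag)
    (v : ∀ k, Fin (d k) → ℂ) : ∃ b ∈ B, ρ b = fun k => Matrix.diagonal (v k) := by
  classical
  obtain ⟨e, heB, he1, hen⟩ := hB.exists_norm_le_one ρ hρ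
  have hstate : ∀ x : Σ k, Fin (d k), diagFunctional ρ x ∈ cstarStates A := fun x =>
    ⟨diagFunctional_nonneg ρ x, norm_eq_one_of_apply_eq_one _ (norm_diagFunctional_le ρ x) e hen
      (by simp [he1])⟩
  let res : (Σ k, Fin (d k)) → (B →L[ℂ] ℂ) := fun x =>
    LinearMap.mkContinuous
      ((diagFunctional ρ x : A →ₗ[ℂ] ℂ).comp (B.toNonUnitalSubalgebra.toSubmodule.subtype)) 1
      fun b => by
        have := (diagFunctional ρ x).le_of_opNorm_le (norm_diagFunctional_le ρ x) (b : A)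
        exact this
  have hres : ∀ x (b : B), res x b = ρ b x.1 x.2 x.2 := fun x b => rfl
  have hpure : ∀ x, res x ∈ cstarPureStates B := by
    intro x
    refine mem_cstarPureStates_of_map_mul ?_ ?_ ?_ hB.mem_closure_mul
    · refine norm_eq_one_of_apply_eq_one _ (LinearMap.mkContinuous_norm_le _ zero_le_one _)
        ⟨e, heB⟩ hen ?_
      rw [hres]; simp [he1]
    · intro a b
      rw [hres, hres, hres]
      simp only [NonUnitalStarSubalgebra.coe_mul, map_mul]
      exact MatSum.mul_apply_diag (hD a a.2) _ _
    · intro a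
      rw [hres, hres]
      simp [map_star, Matrix.star_apply]
  -- Here unique extension is used: distinct diagonal entries are distinct states of `A` by
  -- surjectivity of `ρ`, so their restrictions to `B` must differ.
  have hinj : ∀ x y, res x = res y → x = y := by
    intro x y hxy
    by_contra hne
    have h1 := (hB.uniqueExtension _ (hpure x)).unique
      (y₁ := diagFunctional ρ x) (y₂ := diagFunctional ρ y)
      ⟨hstate x, fun b => rfl⟩ ⟨hstate y, fun b => by rw [hxy]; rfl⟩
    obtain ⟨a, ha⟩ := hρ (Pi.single x.1 (Matrix.single x.2 x.2 1))
    have h2 := congrArg (fun f : A →L[ℂ] ℂ => f a) h1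
    simp only [diagFunctional_apply, ha] at h2
    obtain ⟨k, i⟩ := x
    obtain ⟨l, j⟩ := y
    by_cases hkl : l = k
    · subst hkl
      have hij : i ≠ j := fun h => hne (by rw [h])
      simp [hij] at h2
    · simp [Pi.single_eq_of_ne hkl] at h2
  let S : Subalgebra ℂ ((Σ k, Fin (d k)) → ℂ) :=
    { carrier := {f | ∃ b ∈ B, ∀ x, ρ b x.1 x.2 x.2 = f x}
      mul_mem' := by
        rintro f g ⟨a, ha, haf⟩ ⟨b, hb, hbg⟩
        refine ⟨a * b, mul_mem ha hb, fun x => ?_⟩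
        rw [map_mul, MatSum.mul_apply_diag (hD a ha), haf, hbg, Pi.mul_apply]
      add_mem' := by
        rintro f g ⟨a, ha, haf⟩ ⟨b, hb, hbg⟩
        refine ⟨a + b, add_mem ha hb, fun x => ?_⟩
        simp [map_add, haf, hbg]
      algebraMap_mem' := fun r => ⟨r • e, SMulMemClass.smul_mem r heB, fun x => by simp [he1]⟩ }
  have hsep : ∀ x y, x ≠ y → ∃ f ∈ S, f x = 1 ∧ f y = 0 := by
    intro x y hxy
    obtain ⟨b, hb⟩ : ∃ b, res x b ≠ res y b := by
      by_contra! h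
      exact hxy (hinj _ _ (ContinuousLinearMap.ext h))
    let f : (Σ k, Fin (d k)) → ℂ := fun z => ρ b z.1 z.2 z.2
    have hf : f ∈ S := ⟨b, b.2, fun _ => rfl⟩
    have hfxy : f x - f y ≠ 0 := sub_ne_zero.2 hb
    refine ⟨(f x - f y)⁻¹ • (f - algebraMap ℂ _ (f y)),
      S.smul_mem (S.sub_mem hf (S.algebraMap_mem _)) _, ?_, ?_⟩
    · simp [inv_mul_cancel₀ hfxy]
    · simp
  -- Interpolation: the product over `y ≠ x` of functions that are `1` at `x` and `0` at `y`.
  have hind : ∀ x, Pi.single x (1 : ℂ) ∈ S := by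
    intro x
    choose! f hfS hfx hfy using fun y (hy : x ≠ y) => hsep x y hy
    have : ∏ y ∈ Finset.univ.erase x, f y ∈ S :=
      Subalgebra.prod_mem _ fun y hy => hfS y (Finset.ne_of_mem_erase hy).symm
    convert this using 1
    ext z
    rw [Finset.prod_apply]
    by_cases hz : z = x
    · subst hz
      rw [Pi.single_eq_same, Finset.prod_eq_one]
      intro y hy
      exact hfx y (Finset.ne_of_mem_erase hy).symm
    · rw [Pi.single_eq_of_ne hz, Finset.prod_eq_zero (i := z) (by simp [hz])]
      exact hfy z (Ne.symm hz)
  have hall : (fun x : Σ k, Fin (d k) => v x.1 x.2) ∈ S := by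
    rw [← Finset.univ_sum_single (fun x : Σ k, Fin (d k) => v x.1 x.2)]
    refine S.sum_mem fun x _ => ?_
    have := S.smul_mem (hind x) (v x.1 x.2)
    rwa [← Pi.single_smul, smul_eq_mul, mul_one] at this
  obtain ⟨b, hb, hbv⟩ := hall
  refine ⟨b, hb, ?_⟩
  funext k
  rw [← (hD b hb k).diagonal_diag]
  congr 1
  funext j
  exact hbv ⟨k, j⟩

/-- The unitary `w` conjugates the image of `B` under `π` to the diagonal matrices. -/
structure Diagonalizes (B : NonUnitalStarSubalgebra ℂ A) (π : A →⋆ₙₐ[ℂ] MatSum d)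
    (w : MatSum d) : Prop where
  star_mul_self : star w * w = 1
  mul_star_self : w * star w = 1
  isDiag : ∀ b ∈ B, ∀ k, ((w * π b * star w) k).IsDiag
  exists_eq : ∀ v : ∀ k, Fin (d k) → ℂ,
    ∃ b ∈ B, w * π b * star w = fun k => Matrix.diagonal (v k)

/-- Conjugation of a representation by a unitary. -/
noncomputable def conjRep (π : A →⋆ₙₐ[ℂ] MatSum d) (w : unitary (MatSum d)) : A →⋆ₙₐ[ℂ] MatSum d :=
  (Unitary.conjStarAlgAut ℂ (MatSum d) w : MatSum d →⋆ₙₐ[ℂ] MatSum d).comp π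

theorem conjRep_apply (π : A →⋆ₙₐ[ℂ] MatSum d) (w : unitary (MatSum d)) (a : A) :
    conjRep π w a = (w : MatSum d) * π a * star (w : MatSum d) := rfl

theorem conjRep_surjective {π : A →⋆ₙₐ[ℂ] MatSum d} (hπ : Function.Surjective π)
    (w : unitary (MatSum d)) : Function.Surjective (conjRep π w) :=
  (Unitary.conjStarAlgAut ℂ (MatSum d) w).surjective.comp hπ

theorem IsCStarDiagonal.diagonalizes (hB : IsCStarDiagonal B) {π : A →⋆ₙₐ[ℂ] MatSum d}
    (hπ : Function.Surjective π) {w : MatSum d} (h1 : star w * w = 1) (h2 : w * star w = 1)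
    (hw : ∀ b ∈ B, ∀ k, ((w * π b * star w) k).IsDiag) : Diagonalizes B π w :=
  ⟨h1, h2, hw, fun v => hB.exists_eq_diagonal (conjRep π ⟨w, h1, h2⟩) (conjRep_surjective hπ _) hw v⟩

/-- The self-adjoint part of `B` maps to commuting Hermitian matrices in each block; real and
imaginary parts extend the diagonal form to all of `B`. -/
theorem IsCStarDiagonal.exists_diagonalizes (hB : IsCStarDiagonal B) {π : A →⋆ₙₐ[ℂ] MatSum d}
    (hπ : Function.Surjective π) : ∃ w, Diagonalizes B π w := by
  have H : ∀ k, ∃ w ∈ unitary (Matrix (Fin (d k)) (Fin (d k)) ℂ),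
      ∀ b : {b : B // IsSelfAdjoint (b : A)}, (w * π b k * star w).IsDiag := fun k =>
    Matrix.exists_unitary_isDiag_of_pairwise_commute _
      (fun b => by
        have : star (π (b : A)) = π b := by rw [← map_star, b.2.star_eq]
        exact congrFun this k)
      (fun b c => by
        have := congrArg (fun z => π z k) (hB.commutative b b.1.2 c c.1.2)
        simp only [map_mul] at this
        exact this)
  choose w hwu hw using H
  refine ⟨w, hB.diagonalizes hπ (funext fun k => (hwu k).1) (funext fun k => (hwu k).2) ?_⟩
  intro b hb k
  have h1 : IsSelfAdjoint (b + star b) := IsSelfAdjoint.add_star_self b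
  have h2 : IsSelfAdjoint (Complex.I • (b - star b)) := by
    simp [IsSelfAdjoint, star_smul, ← smul_neg]
  have e1 := hw k ⟨⟨_, add_mem hb (star_mem hb)⟩, h1⟩
  have e2 := hw k ⟨⟨_, SMulMemClass.smul_mem Complex.I (sub_mem hb (star_mem hb))⟩, h2⟩
  have e3 : b = (1 / 2 : ℂ) • (b + star b) + (-Complex.I / 2) • (Complex.I • (b - star b)) := by
    rw [smul_smul, div_mul_eq_mul_div, neg_mul, Complex.I_mul_I, neg_neg, ← smul_add]
    simp [← two_smul ℂ b, smul_smul]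
  have e4 : (w * π b * star w) k = (1 / 2 : ℂ) • (w k * π (b + star b) k * star (w k))
      + (-Complex.I / 2) • (w k * π (Complex.I • (b - star b)) k * star (w k)) := by
    conv_lhs => rw [e3]
    simp only [map_add, map_smul, Pi.mul_apply, Pi.add_apply, Pi.smul_apply, mul_add, add_mul,
      mul_smul_comm, smul_mul_assoc, Pi.star_apply]
  rw [e4]
  exact (e1.smul _).add (e2.smul _)

end Diag

/-! ### Continuous diagonalization near a point -/

section Local

variable {K : Type*} [Fintype K] {d : K → ℕ} {A : Type*} [NonUnitalCStarAlgebra A]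
  {B : NonUnitalStarSubalgebra ℂ A}

/-- The diagonal matrices with prescribed entries. -/
noncomputable def diagHom (d : K → ℕ) : (∀ k, Fin (d k) → ℂ) →⋆ₙₐ[ℂ] MatSum d where
  toFun v := fun k => Matrix.diagonal (v k)
  map_smul' c v := funext fun _ => Matrix.diagonal_smul c (v _)
  map_zero' := funext fun _ => Matrix.diagonal_zero
  map_add' v w := funext fun k => (Matrix.diagonal_add (v k) (w k)).symm
  map_mul' v w := funext fun k => (Matrix.diagonal_mul_diagonal (v k) (w k)).symm
  map_star' v := funext fun k => (Matrix.diagonal_conjTranspose (v k)).symm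

theorem diagHom_apply (v : ∀ k, Fin (d k) → ℂ) : diagHom d v = fun k => Matrix.diagonal (v k) :=
  rfl

theorem NonUnitalStarAlgHom.continuous_of_cstar {R S : Type*} [NonUnitalCStarAlgebra R]
    [NonUnitalCStarAlgebra S] (ρ : R →⋆ₙₐ[ℂ] S) : Continuous ρ :=
  AddMonoidHomClass.continuous_of_bound ρ 1 fun a => by
    rw [one_mul]; exact NonUnitalStarAlgHom.norm_apply_le ρ a

theorem cfcₙ_eq_diagonal (ρ : A →⋆ₙₐ[ℂ] MatSum d) {b : A} (hb : IsSelfAdjoint b)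
    (v : ∀ k, Fin (d k) → ℝ) (hv : ρ b = fun k => Matrix.diagonal fun j => (v k j : ℂ))
    {g : ℝ → ℝ} (hg : Continuous g) (hg0 : g 0 = 0) :
    ρ (cfcₙ g b) = fun k => Matrix.diagonal fun j => (g (v k j) : ℂ) := by
  have hρb : IsSelfAdjoint (ρ b) := hb.map ρ
  let V : ∀ k, Fin (d k) → ℂ := fun k j => v k j
  have hV : IsSelfAdjoint V := by
    funext k j
    exact Complex.conj_ofReal _
  have hVk : ∀ k, IsSelfAdjoint (V k) := fun k => congrFun hV k
  have h1 : ρ b = diagHom d V := hv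
  rw [NonUnitalStarAlgHomClass.map_cfcₙ (S := ℂ) ρ g b hg.continuousOn hg0
    ρ.continuous_of_cstar hb hρb, h1]
  rw [← NonUnitalStarAlgHomClass.map_cfcₙ (S := ℂ) (diagHom d) g V hg.continuousOn hg0
    (diagHom d).continuous_of_cstar hV (h1 ▸ hρb), diagHom_apply]
  funext k
  congr 1
  funext j
  have hVkj : ∀ j, IsSelfAdjoint (V k j) := fun j => congrFun (hVk k) j
  rw [cfcₙ_map_pi (S := ℂ) g V (by exact hg.continuousOn) hV hVk]
  change cfcₙ g (V k) j = _
  rw [cfcₙ_map_pi (S := ℂ) g (V k) (by exact hg.continuousOn) (hVk k) hVkj]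
  change cfcₙ g (V k j) = _
  rw [cfcₙ_eq_cfc hg.continuousOn hg0]
  exact cfc_algebraMap (A := ℂ) (v k j) g

/-- Mutually orthogonal `c j ∈ B` are chosen whose images at `t₀` are the coordinate projections
after conjugation by `w`. Applied to the columns of `star w` they give orthogonal vectors for every
`t`, nonzero for `t` near `t₀`; normalizing them yields the rows of `star (u t)` up to adjoints, and
`B` is diagonal in this basis. -/
theorem IsCStarDiagonal.exists_continuousOn_diagonalizes (hB : IsCStarDiagonal B)
    (π : ℝ → A →⋆ₙₐ[ℂ] MatSum d) (hcont : ∀ a, Continuous fun t => π t a) {t₀ : ℝ}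
    (hsurj : ∀ᶠ t in nhds t₀, Function.Surjective (π t)) :
    ∃ u : ℝ → MatSum d, ∃ U ∈ nhds t₀, ContinuousOn u U ∧ ∀ t ∈ U, Diagonalizes B (π t) (u t) := by
  obtain ⟨w, hw⟩ := hB.exists_diagonalizes hsurj.self_of_nhds
  let W : unitary (MatSum d) := ⟨w, hw.star_mul_self, hw.mul_star_self⟩
  -- The eigenvalues `1, 2, …` are simple in each block; avoiding `0` allows bump functions
  -- vanishing at `0`, as the non-unital functional calculus requires.
  obtain ⟨b₀, hb₀, hb₀v⟩ := hw.exists_eq fun k j => ((j : ℕ) + 1 : ℝ)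
  let b : A := (1 / 2 : ℂ) • (b₀ + star b₀)
  have hb : b ∈ B := SMulMemClass.smul_mem _ (add_mem hb₀ (star_mem hb₀))
  have hbs : IsSelfAdjoint b := by
    simp [IsSelfAdjoint, b, star_smul, add_comm]
  have hbv : conjRep (π t₀) W b
      = fun k => Matrix.diagonal fun j : Fin (d k) => (((j : ℕ) + 1 : ℝ) : ℂ) := by
    have e1 : conjRep (π t₀) W b₀ = diagHom d fun k j => (((j : ℕ) + 1 : ℝ) : ℂ) := hb₀v
    have e2 : star (diagHom d fun k j => (((j : ℕ) + 1 : ℝ) : ℂ))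
        = diagHom d fun k j => (((j : ℕ) + 1 : ℝ) : ℂ) := by
      rw [← map_star]
      congr 1
      funext k j
      exact Complex.conj_ofReal _
    rw [map_smul, map_add, map_star, e1, e2, ← two_smul ℂ (diagHom d _), smul_smul, diagHom_apply]
    simp
  -- Tents of half-width `1/2` around the eigenvalues, so products of different ones vanish.
  let g : ℕ → ℝ → ℝ := fun j s => max 0 (1 - 2 * |s - (j + 1)|)
  have hg : ∀ j, Continuous (g j) := fun j => by fun_prop
  have hg0 : ∀ j, g j 0 = 0 := fun j => by
    have : |(0 : ℝ) - (j + 1)| = j + 1 := by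
      rw [zero_sub, abs_neg, abs_of_nonneg (by positivity)]
    simp only [g, this]
    exact max_eq_left (by linarith [(Nat.cast_nonneg j : (0 : ℝ) ≤ j)])
  have hg1 : ∀ j, g j (j + 1) = 1 := fun j => by simp [g]
  have hgg : ∀ j k, j ≠ k → ∀ s, g j s * g k s = 0 := by
    intro j k hjk s
    have h1 : (1 : ℝ) ≤ |(j : ℝ) - k| := by
      have : (1 : ℤ) ≤ |(j : ℤ) - k| := Int.one_le_abs (sub_ne_zero.2 (by exact_mod_cast hjk))
      exact_mod_cast this
    have h2 : |(j : ℝ) - k| ≤ |s - (j + 1)| + |s - (k + 1)| := by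
      have := abs_sub (s - (k + 1)) (s - (j + 1))
      have e : s - (k + 1) - (s - (j + 1)) = (j : ℝ) - k := by ring
      rw [e] at this
      linarith
    rcases le_total (1 - 2 * |s - (j + 1)|) 0 with h | h
    · simp only [g, max_eq_left h, zero_mul]
    · have : 1 - 2 * |s - (k + 1)| ≤ 0 := by linarith
      simp only [g, max_eq_left this, mul_zero]
  let c : ℕ → A := fun j => cfcₙ (g j) b
  have hcB : ∀ j, c j ∈ B := fun j => hB.cfcₙ_mem hb (g j)
  have hcs : ∀ j, star (c j) = c j := fun j => (cfcₙ_predicate (g j) b : IsSelfAdjoint _)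
  have hcc : ∀ j k, j ≠ k → c j * c k = 0 := by
    intro j k hjk
    rw [← cfcₙ_mul (g j) (g k) b (hg j).continuousOn (hg0 j) (hg k).continuousOn (hg0 k)]
    simp only [hgg j k hjk]
    exact cfcₙ_const_zero ℝ b
  have hct : ∀ j, conjRep (π t₀) W (c j)
      = fun k => Matrix.diagonal fun i : Fin (d k) => (g j ((i : ℕ) + 1) : ℂ) := fun j =>
    cfcₙ_eq_diagonal _ hbs _ hbv (hg j) (hg0 j)
  -- Column `j` of `N t` is `π t (c j)` applied to column `j` of `star w`; only the index inside the
  -- block selects `c j`.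
  let N : ℝ → MatSum d := fun t k => Matrix.of fun a j => (π t (c j) * star w) k a j
  have hN : Continuous N := by
    refine continuous_pi fun k => continuous_matrix fun a j => ?_
    have h1 : Continuous fun t => π t (c j) * star w := (hcont (c j)).mul continuous_const
    have h2 := (continuous_apply k).comp h1
    exact h2.matrix_elem a j
  have hgram : ∀ t x k i j, (star (N t) * π t x * N t) k i j
      = (w * π t (c i * x * c j) * star w) k i j := by
    intro t x k i j
    have e1 : w * π t (c i * x * c j) * star w
        = star (π t (c i) * star w) * π t x * (π t (c j) * star w) := by
      rw [star_mul, star_star, ← map_star, hcs]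
      simp only [map_mul, mul_assoc]
    rw [e1]
    simp only [Pi.mul_apply, Matrix.mul_apply, Pi.star_apply, Matrix.star_apply, N, Matrix.of_apply]
  -- Since `B` is commutative, `c i * x * c j = c i * c j * x = 0` for `i ≠ j`; this is why `B`
  -- becomes diagonal.
  have hgram0 : ∀ t, ∀ x ∈ B, ∀ k i j, i ≠ j → (star (N t) * π t x * N t) k i j = 0 := by
    intro t x hx k i j hij
    rw [hgram, mul_assoc (c i), hB.commutative x hx _ (hcB j), ← mul_assoc, hcc _ _ (by
      intro h; exact hij (Fin.ext h))]
    simp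
  have hgram0' : ∀ t k i j, i ≠ j → (star (N t) * N t) k i j = 0 := by
    intro t k i j hij
    have e1 : (star (N t) * N t) k i j = (w * π t (c i * c j) * star w) k i j := by
      have e1 : w * π t (c i * c j) * star w
          = star (π t (c i) * star w) * (π t (c j) * star w) := by
        rw [star_mul, star_star, ← map_star, hcs]
        simp only [map_mul, mul_assoc]
      rw [e1]
      simp only [Pi.mul_apply, Matrix.mul_apply, Pi.star_apply, Matrix.star_apply, N,
        Matrix.of_apply]
    rw [e1, hcc _ _ (by intro h; exact hij (Fin.ext h))]
    simp
  let r : ℝ → ∀ k, Fin (d k) → ℝ := fun t k j => ∑ a, ‖N t k a j‖ ^ 2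
  have hr : ∀ t k j, (star (N t) * N t) k j j = (r t k j : ℂ) := by
    intro t k j
    simp only [Pi.mul_apply, Matrix.mul_apply, Pi.star_apply, Matrix.star_apply, r]
    rw [Complex.ofReal_sum]
    refine Finset.sum_congr rfl fun a _ => ?_
    rw [Complex.star_def, Complex.conj_mul', Complex.ofReal_pow]
  have hrc : ∀ k j, Continuous fun t => r t k j := by
    intro k j
    refine continuous_finsetSum _ fun a _ => ?_
    have h2 : Continuous fun t => N t k := (continuous_apply k).comp hN
    exact ((h2.matrix_elem a j).norm).pow 2
  have hr0 : ∀ k j, r t₀ k j = 1 := by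
    intro k j
    have e1 : N t₀ = star w := by
      funext k
      ext a j
      have := hct j
      rw [conjRep_apply] at this
      have e2 : π t₀ (c j) * star w = star w * (fun k =>
          Matrix.diagonal fun i : Fin (d k) => (g j ((i : ℕ) + 1) : ℂ)) := by
        rw [← this]
        simp only [← mul_assoc]
        change _ = star w * w * _ * _
        rw [hw.star_mul_self, one_mul]
      change (π t₀ (c j) * star w) k a j = _
      rw [e2, Pi.mul_apply, Matrix.mul_diagonal, hg1]
      simp
    have := hr t₀ k j
    rw [e1, star_star, hw.mul_star_self] at this
    simp at this
    exact_mod_cast this.symm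
  have hev : ∀ᶠ t in nhds t₀, ∀ k j, 0 < r t k j := by
    rw [Filter.eventually_all]
    intro k
    rw [Filter.eventually_all]
    intro j
    exact (hrc k j).continuousAt.eventually_const_lt (by simp [hr0])
  let s : ℝ → ∀ k, Fin (d k) → ℂ := fun t k j => ((Real.sqrt (r t k j))⁻¹ : ℝ)
  let u : ℝ → MatSum d := fun t => diagHom d (s t) * star (N t)
  have hss : ∀ t, star (diagHom d (s t)) = diagHom d (s t) := by
    intro t
    rw [← map_star]
    congr 1
    funext k j
    exact Complex.conj_ofReal _
  refine ⟨u, {t | ∀ k j, 0 < r t k j} ∩ {t | Function.Surjective (π t)},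
    Filter.inter_mem hev hsurj, ?_, ?_⟩
  · refine ContinuousOn.mul ?_ hN.star.continuousOn
    refine (diagHom d).continuous_of_cstar.comp_continuousOn ?_
    refine continuousOn_pi.2 fun k => continuousOn_pi.2 fun j => ?_
    refine Complex.continuous_ofReal.comp_continuousOn ?_
    refine ContinuousOn.inv₀ (Real.continuous_sqrt.comp (hrc k j)).continuousOn ?_
    intro t ht
    exact (Real.sqrt_pos.2 (ht.1 k j)).ne'
  · rintro t ⟨ht, hts⟩
    have huu : u t * star (u t) = 1 := by
      have e : u t * star (u t) = diagHom d (s t) * (star (N t) * N t) * diagHom d (s t) := by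
        simp only [u, star_mul, star_star, hss, mul_assoc]
      rw [e]
      funext k
      ext i j
      rw [Pi.mul_apply, Pi.mul_apply, diagHom_apply, Matrix.mul_diagonal, Matrix.diagonal_mul]
      by_cases hij : i = j
      · subst hij
        rw [hr]
        have := Real.sqrt_pos.2 (ht k i)
        simp only [s, Pi.one_apply, Matrix.one_apply_eq]
        norm_cast
        field_simp
        rw [Real.sq_sqrt (ht k i).le]
      · rw [hgram0' t k i j hij]
        simp [hij]
    have huu' : star (u t) * u t = 1 := by
      funext k
      exact mul_eq_one_comm.1 (congrFun huu k)
    refine hB.diagonalizes hts huu' huu ?_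
    intro x hx k i j hij
    have e : u t * π t x * star (u t)
        = diagHom d (s t) * (star (N t) * π t x * N t) * diagHom d (s t) := by
      simp only [u, star_mul, star_star, hss, mul_assoc]
    rw [e, Pi.mul_apply, Pi.mul_apply, diagHom_apply, Matrix.mul_diagonal, Matrix.diagonal_mul,
      hgram0 t x hx k i j hij]
    simp

end Local

/-! ### Gluing local sections -/

section Glue

variable {M : Type*} [Monoid M] [TopologicalSpace M] [ContinuousMul M] {T : ℝ → Set M}

/-- The transition element at `b` preserves every `T s`, so the second section can be multiplied by
this constant to match the first. -/
theorem exists_continuousOn_Icc_trans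
    (htrans : ∀ t, ∀ u ∈ T t, ∀ v ∈ T t, ∃ g, g * v = u ∧ ∀ s, ∀ x ∈ T s, g * x ∈ T s)
    {a b c : ℝ} (hab : a ≤ b) (hbc : b ≤ c)
    (h1 : ∃ u : ℝ → M, ContinuousOn u (Set.Icc a b) ∧ ∀ t ∈ Set.Icc a b, u t ∈ T t)
    (h2 : ∃ u : ℝ → M, ContinuousOn u (Set.Icc b c) ∧ ∀ t ∈ Set.Icc b c, u t ∈ T t) :
    ∃ u : ℝ → M, ContinuousOn u (Set.Icc a c) ∧ ∀ t ∈ Set.Icc a c, u t ∈ T t := by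
  classical
  obtain ⟨u, huc, hu⟩ := h1
  obtain ⟨v, hvc, hv⟩ := h2
  obtain ⟨g, hg, hgT⟩ := htrans b (u b) (hu b ⟨hab, le_rfl⟩) (v b) (hv b ⟨le_rfl, hbc⟩)
  let w : ℝ → M := fun t => if t ≤ b then u t else g * v t
  have hw1 : Set.EqOn w u (Set.Icc a b) := fun t ht => if_pos ht.2
  have hw2 : Set.EqOn w (fun t => g * v t) (Set.Icc b c) := by
    intro t ht
    rcases ht.1.eq_or_lt with h | h
    · subst h; simp [w, hg]
    · exact if_neg (not_le.2 h)
  refine ⟨w, ?_, fun t ht => ?_⟩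
  · rw [← Set.Icc_union_Icc_eq_Icc hab hbc]
    exact (huc.congr hw1).union_of_isClosed ((continuousOn_const.mul hvc).congr hw2)
      isClosed_Icc isClosed_Icc
  · rcases le_total t b with h | h
    · rw [hw1 ⟨ht.1, h⟩]; exact hu t ⟨ht.1, h⟩
    · rw [hw2 ⟨h, ht.2⟩]; exact hgT _ _ (hv t ⟨h, ht.2⟩)

theorem exists_continuousOn_Icc_of_local
    (hloc : ∀ t, ∃ u : ℝ → M, ∃ U ∈ nhds t, ContinuousOn u U ∧ ∀ s ∈ U, u s ∈ T s)
    (htrans : ∀ t, ∀ u ∈ T t, ∀ v ∈ T t, ∃ g, g * v = u ∧ ∀ s, ∀ x ∈ T s, g * x ∈ T s)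
    {a b : ℝ} (hab : a ≤ b) :
    ∃ u : ℝ → M, ContinuousOn u (Set.Icc a b) ∧ ∀ t ∈ Set.Icc a b, u t ∈ T t := by
  choose u U hU huc hu using hloc
  obtain ⟨t, ht0, htm, ⟨m, hm⟩, hc⟩ := exists_monotone_Icc_subset_open_cover_Icc hab
    (c := fun s : ℝ => (Subtype.val ⁻¹' interior (U s) : Set (Set.Icc a b)))
    (fun s => isOpen_interior.preimage continuous_subtype_val)
    (fun s _ => Set.mem_iUnion.2 ⟨s, mem_interior_iff_mem_nhds.2 (hU s)⟩)
  have key : ∀ k, ∃ v : ℝ → M, ContinuousOn v (Set.Icc a (t k)) ∧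
      ∀ s ∈ Set.Icc a (t k : ℝ), v s ∈ T s := by
    intro k
    induction k with
    | zero =>
      have hsub : Set.Icc a (t 0 : ℝ) ⊆ U a := by
        rw [ht0, Set.Icc_self, Set.singleton_subset_iff]
        exact mem_of_mem_nhds (hU a)
      exact ⟨u a, (huc a).mono hsub, fun s hs => hu a s (hsub hs)⟩
    | succ k ih =>
      refine exists_continuousOn_Icc_trans htrans (t k).2.1 (htm k.le_succ) ih ?_
      obtain ⟨i, hi⟩ := hc k
      have hsub : Set.Icc (t k : ℝ) (t (k + 1)) ⊆ U i := by
        intro s hs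
        have hs' : s ∈ Set.Icc a b := ⟨(t k).2.1.trans hs.1, hs.2.trans (t (k + 1)).2.2⟩
        exact interior_subset (hi (a := ⟨s, hs'⟩) hs)
      exact ⟨u i, (huc i).mono hsub, fun s hs => hu i s (hsub hs)⟩
  have := key m
  rwa [hm m le_rfl] at this

theorem locallyFinite_Icc_intCast : LocallyFinite fun k : ℤ => Set.Icc (k : ℝ) (k + 1) := by
  intro t
  refine ⟨Set.Ioo (t - 1) (t + 1), Ioo_mem_nhds (by linarith) (by linarith), ?_⟩
  refine (Set.finite_Icc (⌊t⌋ - 2) (⌊t⌋ + 2)).subset ?_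
  rintro k ⟨s, ⟨h1, h2⟩, h3, h4⟩
  have h5 := Int.floor_le t
  have h6 := Int.lt_floor_add_one t
  constructor
  · have : ((⌊t⌋ - 2 : ℤ) : ℝ) ≤ k := by push_cast; linarith
    exact_mod_cast this
  · have : (k : ℝ) ≤ ((⌊t⌋ + 2 : ℤ) : ℝ) := by push_cast; linarith
    exact_mod_cast this

/-- Local sections of a family of torsors over the real line with constant transition elements
glue to a global section. -/
theorem exists_continuous_of_local
    (hloc : ∀ t, ∃ u : ℝ → M, ∃ U ∈ nhds t, ContinuousOn u U ∧ ∀ s ∈ U, u s ∈ T s)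
    (htrans : ∀ t, ∀ u ∈ T t, ∀ v ∈ T t, ∃ g, g * v = u ∧ ∀ s, ∀ x ∈ T s, g * x ∈ T s) :
    ∃ u : ℝ → M, Continuous u ∧ ∀ t, u t ∈ T t := by
  have H : ∀ k : ℤ, ∃ u : ℝ → M, ContinuousOn u (Set.Icc (k : ℝ) (k + 1)) ∧
      ∀ t ∈ Set.Icc (k : ℝ) (k + 1), u t ∈ T t := fun k =>
    exists_continuousOn_Icc_of_local hloc htrans (by linarith)
  choose f hfc hf using H
  have hr : ∀ k : ℤ, f k (k + 1) ∈ T (k + 1) := fun k => hf k _ ⟨by linarith, le_rfl⟩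
  have hl : ∀ k : ℤ, f (k + 1) (k + 1) ∈ T (k + 1) := fun k => by
    have := hf (k + 1) (k + 1) ⟨by push_cast; rfl, by push_cast; linarith⟩
    exact this
  choose g hg hgT using fun k : ℤ => htrans (k + 1) _ (hr k) _ (hl k)
  choose g' hg' hgT' using fun k : ℤ => htrans (k + 1) _ (hl k) _ (hr k)
  -- Cumulative products of the transition elements, to the right of `0` and to the left, so that `c
  -- k * f k` agree at the integers.
  let c₁ : ℕ → M := fun m => Nat.rec 1 (fun j x => x * g j) m
  let c₂ : ℕ → M := fun m => Nat.rec 1 (fun j x => x * g' (Int.negSucc j)) m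
  let c : ℤ → M := fun k => Int.rec c₁ (fun m => c₂ (m + 1)) k
  have hcT : ∀ k s, ∀ x ∈ T s, c k * x ∈ T s := by
    have h1 : ∀ m s, ∀ x ∈ T s, c₁ m * x ∈ T s := by
      intro m
      induction m with
      | zero => intro s x hx; simpa [c₁] using hx
      | succ m ih =>
        intro s x hx
        have : c₁ (m + 1) * x = c₁ m * (g m * x) := mul_assoc _ _ _
        rw [this]
        exact ih _ _ (hgT _ _ _ hx)
    have h2 : ∀ m s, ∀ x ∈ T s, c₂ m * x ∈ T s := by
      intro m
      induction m with
      | zero => intro s x hx; simpa [c₂] using hx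
      | succ m ih =>
        intro s x hx
        have : c₂ (m + 1) * x = c₂ m * (g' (Int.negSucc m) * x) := mul_assoc _ _ _
        rw [this]
        exact ih _ _ (hgT' _ _ _ hx)
    intro k
    cases k with
    | ofNat m => exact h1 m
    | negSucc m => exact h2 (m + 1)
  have hc : ∀ k : ℤ, c k * f k (k + 1) = c (k + 1) * f (k + 1) (k + 1) := by
    intro k
    cases k with
    | ofNat m =>
      have : c (Int.ofNat m + 1) = c (Int.ofNat m) * g (Int.ofNat m) := rfl
      rw [this, mul_assoc, hg]
    | negSucc m =>
      have : c (Int.negSucc m) = c (Int.negSucc m + 1) * g' (Int.negSucc m) := by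
        cases m with
        | zero => rfl
        | succ m => rfl
      rw [this, mul_assoc, hg']
  let u : ℝ → M := fun t => c ⌊t⌋ * f ⌊t⌋ t
  have hu : ∀ k : ℤ, Set.EqOn u (fun t => c k * f k t) (Set.Icc (k : ℝ) (k + 1)) := by
    intro k t ht
    rcases ht.2.eq_or_lt with h | h
    · subst h
      have : ⌊(k : ℝ) + 1⌋ = k + 1 := by simp
      simp only [u, this, hc]
    · have : ⌊t⌋ = k := Int.floor_eq_iff.2 ⟨ht.1, h⟩
      simp only [u, this]
  refine ⟨u, ?_, fun t => ?_⟩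
  · refine locallyFinite_Icc_intCast.continuous (Set.iUnion_eq_univ_iff.2 fun t =>
      ⟨⌊t⌋, Int.floor_le t, (Int.lt_floor_add_one t).le⟩) (fun k => isClosed_Icc) fun k => ?_
    exact (continuousOn_const.mul (hfc k)).congr (hu k)
  · exact hcT _ _ _ (hf _ _ ⟨Int.floor_le t, (Int.lt_floor_add_one t).le⟩)

end Glue

/-! ### Diagonalization over the open interval -/

section Section

variable {K : Type*} [Fintype K] {d : K → ℕ} {A : Type*} [NonUnitalCStarAlgebra A]
  {B : NonUnitalStarSubalgebra ℂ A}

/-- The element `g = u * star v` normalizes the diagonal matrices, because every diagonal matrix is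
`v * π b' * star v` for some `b' ∈ B`, and `g` conjugates it to the diagonal matrix `u * π b' * star
u`. This does not involve `π'`, so the transition elements are constant. -/
theorem Diagonalizes.exists_mul_eq (hB : IsCStarDiagonal B) {π : A →⋆ₙₐ[ℂ] MatSum d}
    {u v : MatSum d} (hu : Diagonalizes B π u) (hv : Diagonalizes B π v) :
    ∃ g, g * v = u ∧ ∀ π' : A →⋆ₙₐ[ℂ] MatSum d, Function.Surjective π' →
      ∀ x, Diagonalizes B π' x → Diagonalizes B π' (g * x) := by
  refine ⟨u * star v, by rw [mul_assoc, hv.star_mul_self, mul_one], fun π' hπ' x hx => ?_⟩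
  refine hB.diagonalizes hπ' ?_ ?_ ?_
  · simp only [star_mul, star_star]
    calc star x * (v * star u) * (u * star v * x)
        = star x * (v * (star u * u) * star v) * x := by simp only [mul_assoc]
      _ = 1 := by rw [hu.star_mul_self, mul_one, hv.mul_star_self, mul_one, hx.star_mul_self]
  · simp only [star_mul, star_star]
    calc u * star v * x * (star x * (v * star u))
        = u * (star v * (x * star x) * v) * star u := by simp only [mul_assoc]
      _ = 1 := by rw [hx.mul_star_self, mul_one, hv.star_mul_self, mul_one, hu.mul_star_self]
  · intro b hb
    obtain ⟨b', hb', hbb'⟩ := hv.exists_eq fun k => ((x * π' b * star x) k).diag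
    have h1 : x * π' b * star x = v * π b' * star v := by
      rw [hbb']
      funext k
      exact ((hx.isDiag b hb k).diagonal_diag).symm
    have h2 : u * star v * x * π' b * star (u * star v * x) = u * π b' * star u := by
      calc u * star v * x * π' b * star (u * star v * x)
          = u * star v * (x * π' b * star x) * (v * star u) := by
            simp only [star_mul, star_star, mul_assoc]
        _ = u * ((star v * v) * π b' * (star v * v)) * star u := by
            rw [h1]; simp only [mul_assoc]
        _ = u * π b' * star u := by rw [hv.star_mul_self, one_mul, mul_one]
    intro k
    rw [h2]
    exact hu.isDiag b' hb' k

/-- A C*-diagonal is diagonalized along an open interval by a continuous path of unitaries. -/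
theorem IsCStarDiagonal.exists_continuousOn_Ioo_diagonalizes (hB : IsCStarDiagonal B)
    (π : ℝ → A →⋆ₙₐ[ℂ] MatSum d) (hcont : ∀ a, Continuous fun t => π t a)
    (hsurj : ∀ t ∈ Set.Ioo (0 : ℝ) 1, Function.Surjective (π t)) :
    ∃ u : ℝ → MatSum d, ContinuousOn u (Set.Ioo 0 1) ∧
      ∀ t ∈ Set.Ioo (0 : ℝ) 1, Diagonalizes B (π t) (u t) := by
  have hmem : ∀ s, Real.sigmoid s ∈ Set.Ioo (0 : ℝ) 1 := fun s => by
    rw [← Real.range_sigmoid]; exact ⟨s, rfl⟩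
  have hs : Continuous Real.sigmoid := by fun_prop
  obtain ⟨v, hvc, hv⟩ := exists_continuous_of_local (M := MatSum d)
    (T := fun s => {w | Diagonalizes B (π (Real.sigmoid s)) w})
    (fun s => hB.exists_continuousOn_diagonalizes (fun s => π (Real.sigmoid s))
      (fun a => (hcont a).comp hs) (Filter.Eventually.of_forall fun s => hsurj _ (hmem s)))
    (fun s u hu w hw => by
      obtain ⟨g, hg, hgT⟩ := Diagonalizes.exists_mul_eq hB hu hw
      exact ⟨g, hg, fun s x hx => hgT _ (hsurj _ (hmem s)) x hx⟩)
  -- The inverse of the sigmoid, transporting the section from the line back to `(0,1)`.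
  let l : ℝ → ℝ := fun t => Real.log (t / (1 - t))
  have hl : ∀ t ∈ Set.Ioo (0 : ℝ) 1, Real.sigmoid (l t) = t := by
    intro t ht
    have h1 : 0 < 1 - t := by linarith [ht.2]
    have h0 : 0 < t := ht.1
    rw [Real.sigmoid_def, Real.exp_neg, Real.exp_log (div_pos h0 h1)]
    field_simp
    ring
  refine ⟨fun t => v (l t), hvc.comp_continuousOn ?_, fun t ht => ?_⟩
  · refine ContinuousOn.log ?_ ?_
    · refine ContinuousOn.div continuousOn_id (by fun_prop) fun t ht => ?_
      linarith [ht.2]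
    · intro t ht
      have h1 : 0 < 1 - t := by linarith [ht.2]
      exact (div_pos ht.1 h1).ne'
  · have := hv (l t)
    rwa [Set.mem_ofPred_eq, hl t ht] at this

end Section

/-! ### Normalizers and monomial matrices -/

/-- A matrix is monomial if every row and every column has at most one nonzero entry. -/
def Matrix.IsMonomial {X : Type*} (M : Matrix X X ℂ) : Prop :=
  (∀ a b b', b ≠ b' → M a b * M a b' = 0) ∧ ∀ a a' b, a ≠ a' → M a b * M a' b = 0

section Normalizers

variable {A : Type*} [NonUnitalCStarAlgebra A] {B : NonUnitalStarSubalgebra ℂ A}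

theorem mul_mem_cstarNormalizers {x y : A} (hx : x ∈ cstarNormalizers B)
    (hy : y ∈ cstarNormalizers B) : x * y ∈ cstarNormalizers B := by
  intro b hb
  have h1 := (hx _ (hy b hb).1).1
  have h2 := (hy _ (hx b hb).2).2
  simp only [star_mul, mul_assoc] at h1 h2 ⊢
  exact ⟨h1, h2⟩

theorem star_mem_cstarNormalizers {x : A} (hx : x ∈ cstarNormalizers B) :
    star x ∈ cstarNormalizers B := fun b hb => by
  rw [star_star]
  exact (hx b hb).symm

theorem mem_cstarNormalizers_of_mem {b : A} (hb : b ∈ B) : b ∈ cstarNormalizers B :=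
  fun _ hc => ⟨mul_mem (mul_mem hb hc) (star_mem hb), mul_mem (mul_mem (star_mem hb) hc) hb⟩

/-- Normalizers are closed under products and adjoints, so the generated algebra is their linear
span. -/
theorem adjoin_cstarNormalizers_subset_span {x : A}
    (hx : x ∈ NonUnitalStarAlgebra.adjoin ℂ (cstarNormalizers B)) :
    x ∈ Submodule.span ℂ (cstarNormalizers B) := by
  induction hx using NonUnitalStarAlgebra.adjoin_induction with
  | mem x hx => exact Submodule.subset_span hx
  | add x y _ _ h1 h2 => exact add_mem h1 h2
  | zero => exact zero_mem _
  | smul r x _ h => exact Submodule.smul_mem _ r h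
  | star x hx h =>
    clear hx
    induction h using Submodule.span_induction with
    | mem x hx => exact Submodule.subset_span (star_mem_cstarNormalizers hx)
    | zero => rw [star_zero]; exact zero_mem _
    | add x y _ _ h1 h2 => rw [star_add]; exact add_mem h1 h2
    | smul r x _ h => rw [star_smul]; exact Submodule.smul_mem _ _ h
  | mul x y hx hy h1 h2 =>
    clear hx hy
    induction h1 using Submodule.span_induction with
    | mem x hx =>
      induction h2 using Submodule.span_induction with
      | mem y hy => exact Submodule.subset_span (mul_mem_cstarNormalizers hx hy)
      | zero => rw [mul_zero]; exact zero_mem _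
      | add y z _ _ h1 h2 => rw [mul_add]; exact add_mem h1 h2
      | smul r y _ h => rw [mul_smul_comm]; exact Submodule.smul_mem _ _ h
    | zero => rw [zero_mul]; exact zero_mem _
    | add y z _ _ h1 h2 => rw [add_mul]; exact add_mem h1 h2
    | smul r y _ h => rw [smul_mul_assoc]; exact Submodule.smul_mem _ _ h

variable {K : Type*} [Fintype K] {d : K → ℕ}

/-- If `c ∈ B` lifts the diagonal matrix unit at `b`, then `x * c * star x ∈ B` is diagonal, and its
`(a, a')` entry is the entry of `x` at `(a, b)` times the conjugate of that at `(a', b)`. The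
adjoint of `x` gives the condition on rows. -/
theorem Diagonalizes.isMonomial {π : A →⋆ₙₐ[ℂ] MatSum d} {u : MatSum d} (hu : Diagonalizes B π u)
    {x : A} (hx : x ∈ cstarNormalizers B) (k : K) : ((u * π x * star u) k).IsMonomial := by
  classical
  have key : ∀ y ∈ cstarNormalizers B, ∀ a a' b, a ≠ a' →
      (u * π y * star u) k a b * (u * π y * star u) k a' b = 0 := by
    intro y hy a a' b haa
    obtain ⟨c, hc, hcv⟩ := hu.exists_eq (Pi.single k (Pi.single b 1))
    have h1 := hu.isDiag _ (hy c hc).1 k haa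
    have h2 : u * π (y * c * star y) * star u
        = (u * π y * star u) * (u * π c * star u) * star (u * π y * star u) := by
      calc u * π (y * c * star y) * star u
          = u * π y * 1 * π c * 1 * star (π y) * star u := by
            simp only [map_mul, map_star, mul_one, mul_assoc]
        _ = _ := by
            rw [← hu.star_mul_self]; simp only [star_mul, star_star, mul_assoc]
    rw [h2, hcv, Pi.mul_apply, Pi.mul_apply, Pi.single_eq_same, Matrix.mul_apply,
      Finset.sum_eq_single b] at h1
    · rw [Matrix.mul_diagonal, Pi.single_eq_same, mul_one, Pi.star_apply, Matrix.star_apply] at h1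
      rcases mul_eq_zero.1 h1 with h | h
      · rw [h, zero_mul]
      · rw [star_eq_zero.1 h, mul_zero]
    · intro z _ hz
      rw [Matrix.mul_diagonal, Pi.single_eq_of_ne hz, mul_zero, zero_mul]
    · simp
  refine ⟨fun a b b' hbb => ?_, key x hx⟩
  have h1 := key _ (star_mem_cstarNormalizers hx) b b' a hbb
  have h2 : u * π (star x) * star u = star (u * π x * star u) := by
    simp only [star_mul, star_star, map_star, mul_assoc]
  rw [h2, Pi.star_apply, Matrix.star_apply, Matrix.star_apply, ← star_mul'] at h1
  exact star_eq_zero.1 h1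

/-- The normalizers of a C*-diagonal lift all matrix units of a quotient. -/
theorem IsCStarDiagonal.exists_normalizer [DecidableEq K] (hB : IsCStarDiagonal B)
    {π : A →⋆ₙₐ[ℂ] MatSum d}
    (hπ : Function.Surjective π) {w : MatSum d} (hw : Diagonalizes B π w) (i : K)
    (j k : Fin (d i)) : ∃ x ∈ cstarNormalizers B,
      w * π x * star w = Pi.single i (Matrix.single j k 1) := by
  let W : unitary (MatSum d) := ⟨w, hw.star_mul_self, hw.mul_star_self⟩
  let ρ := conjRep π W
  have hρ : Function.Surjective ρ := conjRep_surjective hπ W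
  -- The normalizers span a dense subspace, so not all of them can vanish at this entry; cutting
  -- down by lifts in `B` of diagonal matrix units then isolates it.
  obtain ⟨x, hx, hx0⟩ : ∃ x ∈ cstarNormalizers B, ρ x i j k ≠ 0 := by
    by_contra! h
    have h1 : ∀ x ∈ Submodule.span ℂ (cstarNormalizers B), ρ x i j k = 0 := by
      intro x hx
      induction hx using Submodule.span_induction with
      | mem x hx => exact h x hx
      | zero => simp
      | add x y _ _ h1 h2 => simp [h1, h2]
      | smul r x _ h => simp [h]
    have hc : Continuous fun x => ρ x i j k :=
      ((continuous_apply i).comp ρ.continuous_of_cstar).matrix_elem j k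
    have h2 : ∀ x, ρ x i j k = 0 := by
      intro x
      have hcl : IsClosed {x | ρ x i j k = 0} := isClosed_eq hc continuous_const
      have := closure_minimal (fun y hy => h1 y (adjoin_cstarNormalizers_subset_span hy)) hcl
      exact this (hB.regular x)
    obtain ⟨a, ha⟩ := hρ (Pi.single i (Matrix.single j k 1))
    have := h2 a
    simp [ha] at this
  obtain ⟨bj, hbj, hbjv⟩ := hw.exists_eq (Pi.single i (Pi.single j 1))
  obtain ⟨bk, hbk, hbkv⟩ := hw.exists_eq (Pi.single i (Pi.single k 1))
  have hD : ∀ l : Fin (d i), (fun m => Matrix.diagonal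
      ((Pi.single i (Pi.single l 1) : ∀ m, Fin (d m) → ℂ) m)) =
      (Pi.single i (Matrix.single l l (1 : ℂ)) : MatSum d) := by
    intro l
    funext m
    by_cases hm : m = i
    · subst hm
      simp [Matrix.diagonal_single]
    · simp [Pi.single_eq_of_ne hm]
  have hρj : ρ bj = Pi.single i (Matrix.single j j 1) := (hbjv.trans (hD j))
  have hρk : ρ bk = Pi.single i (Matrix.single k k 1) := (hbkv.trans (hD k))
  refine ⟨((ρ x i j k)⁻¹ • bj) * x * bk, mul_mem_cstarNormalizers (mul_mem_cstarNormalizers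
    (mem_cstarNormalizers_of_mem (SMulMemClass.smul_mem _ hbj)) hx)
    (mem_cstarNormalizers_of_mem hbk), ?_⟩
  change ρ _ = _
  rw [map_mul, map_mul, map_smul, hρj, hρk]
  funext m
  by_cases hm : m = i
  · subst hm
    simp only [Pi.mul_apply, Pi.smul_apply, Pi.single_eq_same, smul_mul_assoc,
      Matrix.single_mul_mul_single]
    simp [hx0]
  · simp [Pi.single_eq_of_ne hm]

end Normalizers

/-! ### Standard homomorphisms are monomial -/

section Standard

theorem IsDiagMultOne.exists_eq_single {X Y : Type*} [Fintype X] [DecidableEq X] [Fintype Y]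
    [DecidableEq Y] {ι : Matrix X X ℂ →⋆ₙₐ[ℂ] Matrix Y Y ℂ} (hι : IsDiagMultOne ι) (x : X) :
    ∃ (a : Y) (c : ℂ), c ≠ 0 ∧ ι (Matrix.single x x 1) = Matrix.single a a c := by
  have hproj : IsStarProjection (Matrix.single x x (1 : ℂ)) :=
    ⟨by simp [IsIdempotentElem], by simp [IsSelfAdjoint, Matrix.star_eq_conjTranspose]⟩
  have hr := hι.1 _ hproj
  have hd := hι.2 (Matrix.single x x (1 : ℂ)) (by
    rw [← Matrix.diagonal_single]; exact Matrix.isDiag_diagonal _)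
  rw [← hd.diagonal_diag, Matrix.rank_diagonal, ← Matrix.diagonal_single,
    Matrix.rank_diagonal] at hr
  have h1 : Fintype.card {i // (Pi.single x 1 : X → ℂ) i ≠ 0} = 1 := by
    refine Fintype.card_eq_one_iff.2 ⟨⟨x, by simp⟩, fun y => Subtype.ext ?_⟩
    by_contra hne
    exact y.2 (Pi.single_eq_of_ne hne _)
  rw [h1] at hr
  obtain ⟨⟨a, ha⟩, hu⟩ := Fintype.card_eq_one_iff.1 hr
  refine ⟨a, _, ha, ?_⟩
  ext b b'
  by_cases hbb : b = b'
  · subst hbb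
    by_cases hb : a = b
    · subst hb
      simp [Matrix.diagonal_single]
    · rw [Matrix.single_apply_of_ne _ _ _ _ _ (by simp [hb])]
      by_contra hne
      exact hb (congrArg Subtype.val (hu ⟨b, by rw [Matrix.diagonal_single]; exact hne⟩)).symm
  · rw [hd hbb, Matrix.single_apply_of_ne]
    rintro ⟨rfl, rfl⟩
    exact hbb rfl

/-- The image of a matrix unit is a sum over `r` of multiples of the matrix units at `(a (r, j), a
(r, k))`; orthogonality of the rank-one diagonal images makes `a` injective, so no row or column is
hit twice. -/
theorem IsStandardHom.isMonomial {I P : Type*} [Fintype I] [Fintype P] [DecidableEq I]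
    {d : I → ℕ} {n : P → ℕ} {β : MatSum d →⋆ₙₐ[ℂ] MatSum n} (hβ : IsStandardHom β) (p : P) (i : I)
    (j k : Fin (d i)) : (β (Pi.single i (Matrix.single j k 1)) p).IsMonomial := by
  obtain ⟨m, ι, hι, h⟩ := hβ p i
  rw [h]
  choose a c hc hac using hι.exists_eq_single
  have hinj : Function.Injective a := by
    intro x y hxy
    by_contra hne
    have h1 : ι (Matrix.single x x 1) * ι (Matrix.single y y 1) = 0 := by
      rw [← map_mul, Matrix.single_mul_single_of_ne _ _ _ _ hne, map_zero]
    rw [hac, hac, hxy, Matrix.single_mul_single_same] at h1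
    have := congrFun (congrFun h1 (a y)) (a y)
    simp [hc] at this
  have hsum : (1 : Matrix (Fin m) (Fin m) ℂ) ⊗ₖ Matrix.single j k (1 : ℂ)
      = ∑ r, Matrix.single (r, j) (r, k) 1 := by
    ext ⟨r, x⟩ ⟨s, y⟩
    simp only [Matrix.sum_apply, Matrix.kroneckerMap_apply, Matrix.one_apply, Matrix.single_apply,
      Prod.mk.injEq, ite_mul, one_mul, zero_mul]
    by_cases hrs : r = s
    · subst hrs
      rw [Finset.sum_eq_single r] <;> simp +contextual
    · rw [if_neg hrs, Finset.sum_eq_zero]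
      intro q _
      rw [if_neg]
      rintro ⟨⟨rfl, -⟩, rfl, -⟩
      exact hrs rfl
  have hs : ∀ r, ∃ z, ι (Matrix.single (r, j) (r, k) 1) = Matrix.single (a (r, j)) (a (r, k)) z := by
    intro r
    have h1 : Matrix.single (r, j) (r, k) (1 : ℂ) = Matrix.single (r, j) (r, j) 1 *
        Matrix.single (r, j) (r, k) 1 * Matrix.single (r, k) (r, k) 1 := by simp
    rw [h1, map_mul, map_mul, hac, hac, Matrix.single_mul_mul_single]
    exact ⟨_, rfl⟩
  choose z hz using hs
  have hent : ∀ b b', ι ((1 : Matrix (Fin m) (Fin m) ℂ) ⊗ₖ Matrix.single j k (1 : ℂ)) b b' ≠ 0 →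
      ∃ r, a (r, j) = b ∧ a (r, k) = b' := by
    intro b b' hb
    rw [hsum, map_sum, Matrix.sum_apply] at hb
    obtain ⟨r, -, hr⟩ := Finset.exists_ne_zero_of_sum_ne_zero hb
    rw [hz, Matrix.single_apply] at hr
    exact ⟨r, by_contra fun hn => hr (if_neg hn)⟩
  constructor
  · intro b b' b'' hne
    by_contra hb
    obtain ⟨r, hr, hr'⟩ := hent _ _ (left_ne_zero_of_mul hb)
    obtain ⟨s, hs, hs'⟩ := hent _ _ (right_ne_zero_of_mul hb)
    have : r = s := congrArg Prod.fst (hinj (hr.trans hs.symm))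
    exact hne (by rw [← hr', ← hs', this])
  · intro b b' b'' hne
    by_contra hb
    obtain ⟨r, hr, hr'⟩ := hent _ _ (left_ne_zero_of_mul hb)
    obtain ⟨s, hs, hs'⟩ := hent _ _ (right_ne_zero_of_mul hb)
    have : r = s := congrArg Prod.fst (hinj (hr'.trans hs'.symm))
    exact hne (by rw [← hr, ← hs, this])

end Standard

/-! ### Matrix units of direct sums -/

section Units

variable {I : Type*} [DecidableEq I] {d : I → ℕ}

/-- The matrix units of a direct sum of matrix algebras. -/
abbrev MatSum.single (i : I) (j k : Fin (d i)) : MatSum d := Pi.single i (Matrix.single j k 1)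

theorem MatSum.single_mul_single (i : I) (j k l : Fin (d i)) :
    MatSum.single i j k * MatSum.single i k l = MatSum.single i j l := by
  rw [MatSum.single, MatSum.single, ← Pi.single_mul, Matrix.single_mul_single_same, mul_one]

theorem MatSum.single_mul_single_of_ne {i i' : I} {j k : Fin (d i)} {l m : Fin (d i')}
    (h : (⟨i, k⟩ : Σ i, Fin (d i)) ≠ ⟨i', l⟩) :
    MatSum.single i j k * MatSum.single i' l m = 0 := by
  by_cases hi : i = i'
  · subst hi
    have hkl : k ≠ l := fun hk => h (by rw [hk])
    rw [MatSum.single, MatSum.single, ← Pi.single_mul,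
      Matrix.single_mul_single_of_ne _ _ _ _ hkl, Pi.single_zero]
  · funext x
    by_cases hx : x = i
    · subst hx
      simp [Pi.single_eq_of_ne hi]
    · simp [Pi.single_eq_of_ne hx]

theorem MatSum.star_single (i : I) (j k : Fin (d i)) :
    star (MatSum.single i j k) = MatSum.single i k j := by
  rw [MatSum.single, ← Pi.single_star]
  simp [Matrix.star_eq_conjTranspose]

theorem MatSum.eq_sum_single [Fintype I] (a : MatSum d) :
    a = ∑ i, ∑ j, ∑ k, a i j k • MatSum.single i j k := by
  conv_lhs => rw [← Finset.univ_sum_single a]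
  refine Finset.sum_congr rfl fun i _ => ?_
  funext l
  simp only [Finset.sum_apply, Pi.smul_apply]
  by_cases hl : l = i
  · subst hl
    simp only [Pi.single_eq_same, Matrix.smul_single, smul_eq_mul, mul_one]
    exact Matrix.matrix_eq_sum_single (a l)
  · simp [Pi.single_eq_of_ne hl]

end Units

/-! ### Support patterns of monomial representations -/

section Pattern

variable {X : Type*} [Fintype X] [DecidableEq X]

omit [DecidableEq X] in
theorem Matrix.IsMonomial.mul_apply_of_ne_zero {M N : Matrix X X ℂ} (hM : M.IsMonomial) {a b : X}
    (hab : M a b ≠ 0) (c : X) : (M * N) a c = M a b * N b c := by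
  rw [Matrix.mul_apply, Finset.sum_eq_single b]
  · intro e _ he
    rw [(mul_eq_zero.1 (hM.1 a e b he)).resolve_right hab, zero_mul]
  · simp

/-- Only one term of the product survives. For a monomial partial isometry this forces entries of
modulus `0` or `1`. -/
theorem Matrix.IsMonomial.mul_star_mul_apply {M : Matrix X X ℂ} (hM : M.IsMonomial) (a b : X) :
    (M * star M * M) a b = (‖M a b‖ : ℂ) ^ 2 * M a b := by
  by_cases hab : M a b = 0
  · rw [hab, mul_zero, Matrix.mul_assoc, Matrix.mul_apply]
    refine Finset.sum_eq_zero fun e _ => ?_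
    rw [Matrix.mul_apply, Finset.mul_sum]
    refine Finset.sum_eq_zero fun c _ => ?_
    by_cases hca : c = a
    · rw [hca, hab, mul_zero, mul_zero]
    · rcases mul_eq_zero.1 (hM.2 c a e hca) with h | h
      · simp [Matrix.star_apply, h]
      · rw [h, zero_mul]
  · rw [Matrix.mul_assoc, hM.mul_apply_of_ne_zero hab, Matrix.mul_apply, Finset.sum_eq_single a]
    · rw [Matrix.star_apply, Complex.star_def, Complex.conj_mul', mul_comm]
    · intro c _ hc
      rw [(mul_eq_zero.1 (hM.2 c a b hc)).resolve_right hab, mul_zero]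
    · simp

variable {I : Type*} [DecidableEq I] {d : I → ℕ}

theorem apply_single_eq_one {γ : MatSum d →⋆ₙₐ[ℂ] Matrix X X ℂ} {i : I} {j : Fin (d i)}
    (hγ : (γ (MatSum.single i j j)).IsMonomial) {a : X} (h : γ (MatSum.single i j j) a a ≠ 0) :
    γ (MatSum.single i j j) a a = 1 := by
  have h1 : (γ (MatSum.single i j j) * γ (MatSum.single i j j)) a a
      = γ (MatSum.single i j j) a a := by rw [← map_mul, MatSum.single_mul_single]
  rw [hγ.mul_apply_of_ne_zero h] at h1
  exact mul_left_cancel₀ h (by rw [h1, mul_one])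

theorem exists_trace_eq_natCast (γ : MatSum d →⋆ₙₐ[ℂ] Matrix X X ℂ)
    (hγ : ∀ i j k, (γ (MatSum.single i j k)).IsMonomial) :
    ∃ N : I → ℕ, ∀ i j, (γ (MatSum.single i j j)).trace = N i := by
  classical
  have h1 : ∀ i j k, (γ (MatSum.single i j j)).trace = (γ (MatSum.single i k k)).trace := by
    intro i j k
    rw [← MatSum.single_mul_single i j k j, map_mul, Matrix.trace_mul_comm, ← map_mul,
      MatSum.single_mul_single]
  have h2 : ∀ i j, ∃ N : ℕ, (γ (MatSum.single i j j)).trace = N := by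
    intro i j
    refine ⟨(Finset.univ.filter fun a => γ (MatSum.single i j j) a a ≠ 0).card, ?_⟩
    rw [Matrix.trace, ← Finset.sum_boole]
    refine Finset.sum_congr rfl fun a _ => ?_
    rw [Matrix.diag_apply]
    split_ifs with h
    · exact apply_single_eq_one (hγ i j j) h
    · exact not_not.1 h
  have h3 : ∀ i, ∃ N : ℕ, ∀ j, (γ (MatSum.single i j j)).trace = N := by
    intro i
    rcases isEmpty_or_nonempty (Fin (d i)) with h | ⟨⟨k⟩⟩
    · exact ⟨0, fun j => isEmptyElim j⟩
    · obtain ⟨N, hN⟩ := h2 i k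
      exact ⟨N, fun j => by rw [h1 i j k, hN]⟩
  exact ⟨fun i => (h3 i).choose, fun i => (h3 i).choose_spec⟩

/-- The support of a monomial representation is a disjoint union of copies of the trivial
equivalence relations, with multiplicities given by traces. -/
theorem exists_injective_norm_eq_ite (γ : MatSum d →⋆ₙₐ[ℂ] Matrix X X ℂ)
    (hγ : ∀ i j k, (γ (MatSum.single i j k)).IsMonomial) (N : I → ℕ)
    (hN : ∀ i j, (γ (MatSum.single i j j)).trace = N i) :
    ∃ κ : (Σ i, Fin (N i) × Fin (d i)) → X, Function.Injective κ ∧ ∀ i j k a b,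
      (γ (MatSum.single i j k) a b ≠ 0 ↔ ∃ r, a = κ ⟨i, r, j⟩ ∧ b = κ ⟨i, r, k⟩) ∧
      (γ (MatSum.single i j k) a b ≠ 0 → ‖γ (MatSum.single i j k) a b‖ = 1) := by
  classical
  have hmul : ∀ i j k l, γ (MatSum.single i j k) * γ (MatSum.single i k l)
      = γ (MatSum.single i j l) := fun i j k l => by rw [← map_mul, MatSum.single_mul_single]
  have hstar : ∀ i j k, star (γ (MatSum.single i j k)) = γ (MatSum.single i k j) :=
    fun i j k => by rw [← map_star, MatSum.star_single]
  have hsymm : ∀ {i j k a b}, γ (MatSum.single i j k) a b ≠ 0 → γ (MatSum.single i k j) b a ≠ 0 := by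
    intro i j k a b h
    rw [← hstar, Matrix.star_apply]
    exact star_ne_zero.2 h
  have htrans : ∀ {i j k l a b c}, γ (MatSum.single i j k) a b ≠ 0 →
      γ (MatSum.single i k l) b c ≠ 0 → γ (MatSum.single i j l) a c ≠ 0 := by
    intro i j k l a b c h1 h2
    rw [← hmul i j k l, (hγ i j k).mul_apply_of_ne_zero h1]
    exact mul_ne_zero h1 h2
  have hfun : ∀ {i j k a b b'}, γ (MatSum.single i j k) a b ≠ 0 →
      γ (MatSum.single i j k) a b' ≠ 0 → b = b' := by
    intro i j k a b b' h1 h2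
    by_contra hne
    exact mul_ne_zero h1 h2 ((hγ i j k).1 a b b' hne)
  have hdisj : ∀ {i i' j k l m a b c}, γ (MatSum.single i j k) a b ≠ 0 →
      γ (MatSum.single i' l m) b c ≠ 0 → (⟨i, k⟩ : Σ i, Fin (d i)) = ⟨i', l⟩ := by
    intro i i' j k l m a b c h1 h2
    by_contra hne
    have h3 : (γ (MatSum.single i j k) * γ (MatSum.single i' l m)) a c = 0 := by
      rw [← map_mul, MatSum.single_mul_single_of_ne hne, map_zero, Matrix.zero_apply]
    rw [(hγ i j k).mul_apply_of_ne_zero h1] at h3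
    exact mul_ne_zero h1 h2 h3
  have hex : ∀ {i j a}, γ (MatSum.single i j j) a a ≠ 0 → ∀ k,
      ∃ b, γ (MatSum.single i j k) a b ≠ 0 := by
    intro i j a h k
    rw [← hmul i j k j, Matrix.mul_apply] at h
    obtain ⟨b, -, hb⟩ := Finset.exists_ne_zero_of_sum_ne_zero h
    exact ⟨b, left_ne_zero_of_mul hb⟩
  have hcard : ∀ i j, Fintype.card {a // γ (MatSum.single i j j) a a ≠ 0} = N i := by
    intro i j
    have h1 := hN i j
    rw [Matrix.trace] at h1
    have h2 : ∑ a, (γ (MatSum.single i j j)).diag a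
        = ∑ a, if γ (MatSum.single i j j) a a ≠ 0 then (1 : ℂ) else 0 := by
      refine Finset.sum_congr rfl fun a _ => ?_
      rw [Matrix.diag_apply]
      split_ifs with h
      · exact apply_single_eq_one (hγ i j j) h
      · exact not_not.1 h
    rw [h2, Finset.sum_boole] at h1
    rw [Fintype.card_subtype]
    exact_mod_cast h1
  have hloc : ∀ i, ∃ κ : Fin (N i) → Fin (d i) → X, (∀ r s j, κ r j = κ s j → r = s) ∧
      ∀ j k a b, γ (MatSum.single i j k) a b ≠ 0 ↔ ∃ r, a = κ r j ∧ b = κ r k := by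
    intro i
    by_cases hd : d i = 0
    · have : IsEmpty (Fin (d i)) := by rw [hd]; infer_instance
      exact ⟨fun _ j => isEmptyElim j, fun _ _ j => isEmptyElim j, fun j => isEmptyElim j⟩
    · let o : Fin (d i) := ⟨0, Nat.pos_of_ne_zero hd⟩
      let e : Fin (N i) ≃ {a // γ (MatSum.single i o o) a a ≠ 0} :=
        (Fintype.equivFinOfCardEq (hcard i o)).symm
      choose κ hκ using fun r j => hex (e r).2 j
      refine ⟨κ, fun r s j h => ?_, fun j k a b => ⟨fun h => ?_, ?_⟩⟩
      · have h1 := hsymm (hκ r j)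
        rw [h] at h1
        exact e.injective (Subtype.ext (hfun h1 (hsymm (hκ s j))))
      · obtain ⟨c, hc⟩ := hex (htrans h (hsymm h)) o
        obtain ⟨r, hr⟩ := e.surjective ⟨c, htrans (hsymm hc) hc⟩
        have hrc : (e r : X) = c := by rw [hr]
        have h1 := hκ r j
        have h2 := hκ r k
        rw [hrc] at h1 h2
        exact ⟨r, hfun (hsymm hc) h1, hfun (htrans (hsymm hc) h) h2⟩
      · rintro ⟨r, rfl, rfl⟩
        exact htrans (hsymm (hκ r j)) (hκ r k)
  choose κ hκi hκ using hloc
  refine ⟨fun x => κ x.1 x.2.1 x.2.2, ?_, fun i j k a b => ⟨hκ i j k a b, fun h => ?_⟩⟩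
  · rintro ⟨i, r, j⟩ ⟨i', r', j'⟩ h
    have h1 := (hκ i j j _ _).2 ⟨r, rfl, rfl⟩
    have h2 := (hκ i' j' j' _ _).2 ⟨r', rfl, rfl⟩
    change κ i r j = κ i' r' j' at h
    rw [← h] at h2
    have h3 := hdisj h1 h2
    obtain ⟨rfl, h4⟩ := Sigma.mk.inj h3
    obtain rfl := eq_of_heq h4
    rw [hκi i r r' j h]
  · have h1 := (hγ i j k).mul_star_mul_apply a b
    rw [hstar, hmul, hmul] at h1
    have h2 : (‖γ (MatSum.single i j k) a b‖ : ℂ) ^ 2 = 1 :=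
      mul_right_cancel₀ h (by rw [← h1, one_mul])
    have h3 : ‖γ (MatSum.single i j k) a b‖ ^ 2 = 1 := by exact_mod_cast h2
    exact (pow_eq_one_iff_of_nonneg (norm_nonneg _) two_ne_zero).1 h3

end Pattern

/-! ### Moduli and phases near an end point -/

open Filter Topology

/-- The only nonnegative zeros of `x - x ^ 3` are `0` and `1`. Near `0` the value `1/2`, where it
equals `3/8`, is not attained, so by the intermediate value theorem `f` stays on one side. -/
theorem tendsto_zero_or_one_of_sub_cube {f : ℝ → ℝ} (hf : ContinuousOn f (Set.Ioo 0 1))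
    (hf0 : ∀ t, 0 ≤ f t) (h : Tendsto (fun t => f t - f t ^ 3) (𝓝[>] 0) (𝓝 0)) :
    Tendsto f (𝓝[>] 0) (𝓝 0) ∨ Tendsto f (𝓝[>] 0) (𝓝 1) := by
  have h1 : ∀ᶠ t in 𝓝[>] (0 : ℝ), f t - f t ^ 3 < 3 / 8 :=
    h.eventually_lt_const (by norm_num)
  obtain ⟨ε, hε, hεf⟩ := (mem_nhdsGT_iff_exists_Ioo_subset' (zero_lt_one' ℝ)).1
    (Filter.inter_mem h1 (Ioo_mem_nhdsGT (zero_lt_one' ℝ)))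
  have hne : ∀ t ∈ Set.Ioo 0 ε, f t ≠ 1 / 2 := by
    intro t ht h2
    have := (hεf ht).1
    simp only [Set.mem_ofPred_eq, h2] at this
    norm_num at this
  have hmem : Set.Ioo 0 ε ∈ 𝓝[>] (0 : ℝ) := Ioo_mem_nhdsGT hε
  have hcε : ContinuousOn f (Set.Ioo 0 ε) := hf.mono fun t ht => (hεf ht).2
  by_cases hlt : ∀ t ∈ Set.Ioo 0 ε, f t < 1 / 2
  · left
    refine squeeze_zero' (Eventually.of_forall hf0) ?_ (by simpa using h.const_mul (4 / 3))
    filter_upwards [hmem] with t ht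
    nlinarith [hlt t ht, hf0 t, mul_nonneg (hf0 t) (hf0 t)]
  · right
    push Not at hlt
    obtain ⟨s, hs, hs2⟩ := hlt
    have hgt : ∀ t ∈ Set.Ioo 0 ε, 1 / 2 < f t := by
      intro t ht
      by_contra hle
      obtain ⟨r, hr, hr2⟩ := isPreconnected_Ioo.intermediate_value ht hs hcε
        ⟨not_lt.1 hle, hs2⟩
      exact hne r hr hr2
    rw [tendsto_iff_norm_sub_tendsto_zero]
    have h3 : Tendsto (fun t => 4 / 3 * ‖f t - f t ^ 3‖) (𝓝[>] 0) (𝓝 0) := by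
      simpa using h.norm.const_mul (4 / 3)
    refine squeeze_zero' (Eventually.of_forall fun _ => norm_nonneg _) ?_ h3
    filter_upwards [hmem] with t ht
    have e : f t - f t ^ 3 = -(f t * (1 + f t)) * (f t - 1) := by ring
    rw [e, norm_mul]
    have h4 : 3 / 4 ≤ ‖-(f t * (1 + f t))‖ := by
      rw [norm_neg, Real.norm_of_nonneg (by nlinarith [hf0 t])]
      nlinarith [hgt t ht]
    nlinarith [norm_nonneg (f t - 1)]

/-- A family of nonvanishing functions near `0` can be normalized and continued to a continuous
family of phases which is trivial on `[1/2, 1)`. -/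
theorem exists_phases {X : Type*} [Fintype X] (Φ : X → ℝ → ℂ)
    (hc : ∀ a, ContinuousOn (Φ a) (Set.Ioo 0 1)) (h0 : ∀ a, ∀ᶠ t in 𝓝[>] (0 : ℝ), Φ a t ≠ 0) :
    ∃ c : ℝ → X → ℂ, (∀ a, ContinuousOn (fun t => c t a) (Set.Ioo 0 1)) ∧
      (∀ t ∈ Set.Ioo (0 : ℝ) 1, ∀ a, ‖c t a‖ = 1) ∧ (∀ t, 1 / 2 ≤ t → ∀ a, c t a = 1) ∧
      ∀ a, Tendsto (fun t => c t a * (Φ a t / ‖Φ a t‖)⁻¹) (𝓝[>] 0) (𝓝 1) := by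
  obtain ⟨ε', hε', hε'f⟩ := (mem_nhdsGT_iff_exists_Ioo_subset' (show (0 : ℝ) < 1 / 2 by norm_num)).1
    (Filter.inter_mem (eventually_all.2 h0) (Ioo_mem_nhdsGT (show (0 : ℝ) < 1 / 2 by norm_num)))
  set ε := ε' / 2 with hεdef
  have hε : 0 < ε := half_pos hε'
  have hΦ : ∀ t ∈ Set.Ioc 0 ε, (∀ a, Φ a t ≠ 0) ∧ t < 1 / 2 := by
    intro t ht
    have := hε'f (show t ∈ Set.Ioo 0 ε' from ⟨ht.1, by
      have : ε < ε' := half_lt_self hε'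
      exact lt_of_le_of_lt ht.2 this⟩)
    exact ⟨this.1, this.2.2⟩
  have hε2 : ε < 1 / 2 := (hΦ ε ⟨hε, le_rfl⟩).2
  let S : X → ℝ → ℂ := fun a t => Φ a t / ‖Φ a t‖
  have hS : ∀ a, ∀ t ∈ Set.Ioc 0 ε, ‖S a t‖ = 1 := by
    intro a t ht
    have := norm_ne_zero_iff.2 ((hΦ t ht).1 a)
    simp [S, this]
  have hSc : ∀ a, ContinuousOn (S a) (Set.Ioc 0 ε) := by
    intro a
    have h1 : ContinuousOn (Φ a) (Set.Ioc 0 ε) := (hc a).mono fun t ht => ⟨ht.1, by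
      linarith [ht.2]⟩
    refine h1.div (Complex.continuous_ofReal.comp_continuousOn h1.norm) fun t ht => ?_
    exact_mod_cast norm_ne_zero_iff.2 ((hΦ t ht).1 a)
  -- The phase of `Φ a` is followed up to `ε` and then frozen, while the exponential rotates from
  -- `1` at `t = 0` to the inverse of the frozen phase at `t = 1/2`.
  let c : ℝ → X → ℂ := fun t a =>
    S a (min t ε) * Complex.exp ((-(Complex.arg (S a ε) * min (2 * t) 1) : ℝ) * Complex.I)
  have hmin : ∀ t ∈ Set.Ioo (0 : ℝ) 1, min t ε ∈ Set.Ioc 0 ε := fun t ht =>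
    ⟨lt_min ht.1 hε, min_le_right _ _⟩
  refine ⟨c, fun a => ?_, fun t ht a => ?_, fun t ht a => ?_, fun a => ?_⟩
  · refine ContinuousOn.mul ((hSc a).comp (by fun_prop) hmin) (Continuous.continuousOn ?_)
    fun_prop
  · simp only [c, norm_mul]
    rw [hS a _ (hmin t ht), Complex.norm_exp_ofReal_mul_I, one_mul]
  · have h1 : min t ε = ε := min_eq_right (by linarith)
    have h2 : min (2 * t) 1 = 1 := min_eq_right (by linarith)
    simp only [c, h1, h2, mul_one]
    have h3 : S a ε = Complex.exp (Complex.arg (S a ε) * Complex.I) := by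
      have := Complex.norm_mul_exp_arg_mul_I (S a ε)
      rw [hS a ε ⟨hε, le_rfl⟩, Complex.ofReal_one, one_mul] at this
      exact this.symm
    rw [Complex.ofReal_neg, neg_mul, Complex.exp_neg, ← h3]
    refine mul_inv_cancel₀ fun h => ?_
    have := hS a ε ⟨hε, le_rfl⟩
    simp [h] at this
  · have h1 : Tendsto (fun t : ℝ =>
        Complex.exp ((-(Complex.arg (S a ε) * min (2 * t) 1) : ℝ) * Complex.I)) (𝓝[>] 0) (𝓝 1) := by
      have : Continuous fun t : ℝ =>
        Complex.exp ((-(Complex.arg (S a ε) * min (2 * t) 1) : ℝ) * Complex.I) := by fun_prop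
      have := (this.tendsto 0).mono_left (nhdsWithin_le_nhds (s := Set.Ioi 0))
      simpa using this
    refine h1.congr' ?_
    filter_upwards [Ioo_mem_nhdsGT hε] with t ht
    have h2 : min t ε = t := min_eq_left ht.2.le
    have h3 : S a t ≠ 0 := fun h => by
      have := hS a t ⟨ht.1, ht.2.le⟩
      simp [h] at this
    simp only [c, h2]
    change _ = S a t * _ * (S a t)⁻¹
    field_simp

theorem Function.Injective.exists_perm {Λ X : Type*} [Finite X] {f g : Λ → X}
    (hf : Function.Injective f) (hg : Function.Injective g) :
    ∃ σ : Equiv.Perm X, ∀ x, σ (f x) = g x := by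
  classical
  have := Fintype.ofFinite X
  let e : {x // x ∈ Set.range f} ≃ {x // x ∈ Set.range g} :=
    (Equiv.ofInjective f hf).symm.trans (Equiv.ofInjective g hg)
  refine ⟨e.extendSubtype, fun x => ?_⟩
  rw [e.extendSubtype_apply_of_mem _ ⟨x, rfl⟩]
  have : (Equiv.ofInjective f hf).symm ⟨f x, ⟨x, rfl⟩⟩ = x :=
    (Equiv.ofInjective f hf).symm_apply_apply x
  simp [e, this]

/-! ### Correcting a path of unitaries at an end point -/

section EndPoint

variable {X : Type*} [Fintype X] [DecidableEq X] {I : Type*} [DecidableEq I] {d : I → ℕ}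

theorem Matrix.norm_le_one_of_star_mul_self {u : Matrix X X ℂ} (hu : star u * u = 1) : ‖u‖ ≤ 1 := by
  have h1 : ‖(1 : Matrix X X ℂ)‖ ≤ 1 := by
    rw [← Matrix.diagonal_one, Matrix.l2_opNorm_diagonal]
    exact (pi_norm_le_iff_of_nonneg zero_le_one).2 fun _ => by simp
  have h2 := CStarRing.norm_star_mul_self (x := u)
  rw [hu] at h2
  nlinarith [norm_nonneg u]

theorem Matrix.norm_conj_le {u : Matrix X X ℂ} (hu : star u * u = 1) (x : Matrix X X ℂ) :
    ‖u * x * star u‖ ≤ ‖x‖ := by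
  have h1 := Matrix.norm_le_one_of_star_mul_self hu
  have h2 : ‖star u‖ ≤ 1 := by rwa [norm_star]
  calc ‖u * x * star u‖ ≤ ‖u‖ * ‖x‖ * ‖star u‖ :=
        (norm_mul_le _ _).trans (mul_le_mul_of_nonneg_right (norm_mul_le _ _) (norm_nonneg _))
    _ ≤ 1 * ‖x‖ * 1 := by gcongr
    _ = ‖x‖ := by ring

theorem exists_ultrafilter_limit {α : Type*} (U : Ultrafilter α) (u : α → Matrix X X ℂ)
    (hu : ∀ᶠ t in (U : Filter α), star (u t) * u t = 1) :
    ∃ v, star v * v = 1 ∧ Tendsto u U (𝓝 v) := by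
  have : ProperSpace (Matrix X X ℂ) := FiniteDimensional.proper ℂ _
  obtain ⟨v, -, hv⟩ := (isCompact_closedBall (0 : Matrix X X ℂ) 1).ultrafilter_le_nhds (U.map u) (by
    rw [Ultrafilter.coe_map, le_principal_iff, mem_map]
    filter_upwards [hu] with t ht
    simpa using Matrix.norm_le_one_of_star_mul_self ht)
  have hv' : Tendsto u U (𝓝 v) := hv
  refine ⟨v, ?_, hv'⟩
  have h1 : Tendsto (fun t => star (u t) * u t) U (𝓝 (star v * v)) := hv'.star.mul hv'
  exact tendsto_nhds_unique h1 ((tendsto_congr' hu).2 tendsto_const_nhds)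

/-- Conjugation of a matrix representation by a unitary. -/
noncomputable def conjMatrix (γ : MatSum d →⋆ₙₐ[ℂ] Matrix X X ℂ) (v : Matrix X X ℂ)
    (hv : star v * v = 1) : MatSum d →⋆ₙₐ[ℂ] Matrix X X ℂ :=
  (Unitary.conjStarAlgAut ℂ (Matrix X X ℂ) ⟨v, hv, mul_eq_one_comm.1 hv⟩ :
    Matrix X X ℂ →⋆ₙₐ[ℂ] Matrix X X ℂ).comp γ

omit [DecidableEq I] in
theorem conjMatrix_apply (γ : MatSum d →⋆ₙₐ[ℂ] Matrix X X ℂ) (v : Matrix X X ℂ)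
    (hv : star v * v = 1) (a : MatSum d) : conjMatrix γ v hv a = v * γ a * star v := rfl

theorem Matrix.tendsto_apply {α : Type*} {l : Filter α} {f : α → Matrix X X ℂ} {M : Matrix X X ℂ}
    (h : Tendsto f l (𝓝 M)) (a b : X) : Tendsto (fun t => f t a b) l (𝓝 (M a b)) :=
  (((continuous_id.matrix_elem a b).tendsto M).comp h)

theorem Matrix.tendsto_of_apply {α : Type*} {l : Filter α} {f : α → Matrix X X ℂ} {M : Matrix X X ℂ}
    (h : ∀ a b, Tendsto (fun t => f t a b) l (𝓝 (M a b))) : Tendsto f l (𝓝 M) :=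
  tendsto_pi_nhds.2 fun a => tendsto_pi_nhds.2 fun b => h a b

theorem Matrix.perm_conj_apply (σ : Equiv.Perm X) (M : Matrix X X ℂ) (a b : X) :
    (σ.permMatrix ℂ * M * star (σ.permMatrix ℂ)) a b = M (σ a) (σ b) := by
  rw [Matrix.star_eq_conjTranspose, Matrix.conjTranspose_permMatrix]
  simp only [Equiv.Perm.permMatrix]
  rw [PEquiv.toMatrix_toPEquiv_mul, PEquiv.mul_toMatrix_toPEquiv]
  rfl

theorem Matrix.star_permMatrix_mul_self (σ : Equiv.Perm X) :
    star (σ.permMatrix ℂ) * σ.permMatrix ℂ = 1 := by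
  rw [Matrix.star_eq_conjTranspose, Matrix.conjTranspose_permMatrix, ← Matrix.permMatrix_mul]
  simp

/-- Two unitarily equivalent monomial representations, one of them given asymptotically along a
path, become asymptotically equal after a permutation and a change of phases. -/
theorem exists_perm_phases_tendsto [Fintype I] (β β' : MatSum d →⋆ₙₐ[ℂ] Matrix X X ℂ)
    (hβ : ∀ i j k, (β (MatSum.single i j k)).IsMonomial)
    (htr : ∀ i j, (β' (MatSum.single i j j)).trace = (β (MatSum.single i j j)).trace)
    (u : ℝ → Matrix X X ℂ) (hu : ∀ t ∈ Set.Ioo (0 : ℝ) 1, star (u t) * u t = 1)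
    (y : ∀ i, Fin (d i) → Fin (d i) → ℝ → Matrix X X ℂ)
    (hyc : ∀ i j k, ContinuousOn (y i j k) (Set.Ioo 0 1))
    (hym : ∀ i j k, ∀ t ∈ Set.Ioo (0 : ℝ) 1, (y i j k t).IsMonomial)
    (hy : ∀ i j k, Tendsto (fun t => y i j k t - u t * β' (MatSum.single i j k) * star (u t))
      (𝓝[>] 0) (𝓝 0)) :
    ∃ (σ : Equiv.Perm X) (c : ℝ → X → ℂ), (∀ a, ContinuousOn (fun t => c t a) (Set.Ioo 0 1)) ∧
      (∀ t ∈ Set.Ioo (0 : ℝ) 1, ∀ a, ‖c t a‖ = 1) ∧ (∀ t, 1 / 2 ≤ t → ∀ a, c t a = 1) ∧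
      ∀ x, Tendsto (fun t => (Matrix.diagonal (c t) * σ.permMatrix ℂ * u t) * β' x *
        star (Matrix.diagonal (c t) * σ.permMatrix ℂ * u t)) (𝓝[>] 0) (𝓝 (β x)) := by
  have hIoo : Set.Ioo (0 : ℝ) 1 ∈ 𝓝[>] (0 : ℝ) := Ioo_mem_nhdsGT one_pos
  -- By compactness `u` converges along every ultrafilter at `0`, and the limit conjugates `β'` to a
  -- representation that is monomial, as a limit of monomial matrices, with the traces of `β`.
  have hlim : ∀ U : Ultrafilter ℝ, (U : Filter ℝ) ≤ 𝓝[>] 0 →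
      ∃ γ : MatSum d →⋆ₙₐ[ℂ] Matrix X X ℂ, (∀ i j k, (γ (MatSum.single i j k)).IsMonomial) ∧
        (∀ i j, (γ (MatSum.single i j j)).trace = (β (MatSum.single i j j)).trace) ∧
        ∀ i j k, Tendsto (y i j k) U (𝓝 (γ (MatSum.single i j k))) := by
    intro U hU
    obtain ⟨v, hv, hvt⟩ := exists_ultrafilter_limit U u (hU (mem_of_superset hIoo hu))
    have ht : ∀ i j k, Tendsto (y i j k) U (𝓝 (conjMatrix β' v hv (MatSum.single i j k))) := by
      intro i j k
      have h1 : Tendsto (fun t => u t * β' (MatSum.single i j k) * star (u t)) U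
        (𝓝 (v * β' (MatSum.single i j k) * star v)) := (hvt.mul tendsto_const_nhds).mul hvt.star
      have h2 := ((hy i j k).mono_left hU).add h1
      simpa [conjMatrix_apply] using h2
    refine ⟨conjMatrix β' v hv, fun i j k => ?_, fun i j => ?_, ht⟩
    · have h1 : ∀ᶠ t in (U : Filter ℝ), (y i j k t).IsMonomial :=
        hU (mem_of_superset hIoo (hym i j k))
      refine ⟨fun a b b' hbb => ?_, fun a a' b haa => ?_⟩
      · refine tendsto_nhds_unique ((Matrix.tendsto_apply (ht i j k) a b).mul
          (Matrix.tendsto_apply (ht i j k) a b')) ?_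
        exact (tendsto_congr' (h1.mono fun t ht => ht.1 a b b' hbb)).2 tendsto_const_nhds
      · refine tendsto_nhds_unique ((Matrix.tendsto_apply (ht i j k) a b).mul
          (Matrix.tendsto_apply (ht i j k) a' b)) ?_
        exact (tendsto_congr' (h1.mono fun t ht => ht.2 a a' b haa)).2 tendsto_const_nhds
    · rw [conjMatrix_apply, Matrix.mul_assoc, Matrix.trace_mul_comm, Matrix.mul_assoc, hv,
        Matrix.mul_one, htr]
  obtain ⟨N, hN⟩ := exists_trace_eq_natCast β hβ
  obtain ⟨κ, hκ, hκβ⟩ := exists_injective_norm_eq_ite β hβ N hN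
  let U₀ : Ultrafilter ℝ := Ultrafilter.of (𝓝[>] 0)
  have hU₀ : (U₀ : Filter ℝ) ≤ 𝓝[>] 0 := Ultrafilter.of_le _
  obtain ⟨γ, hγ, hγtr, hγy⟩ := hlim U₀ hU₀
  obtain ⟨κ', hκ', hκγ⟩ := exists_injective_norm_eq_ite γ hγ N fun i j => (hγtr i j).trans (hN i j)
  obtain ⟨σ, hσ⟩ := hκ.exists_perm hκ'
  -- Along each ultrafilter the limit has modulus `0` or `1`, so `f - f ^ 3 → 0` for the modulus
  -- `f`; continuity then gives a genuine limit, independent of the ultrafilter. Hence one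
  -- permutation, found from `U₀`, works for all.
  have hdich : ∀ i j k a b, Tendsto (fun t => ‖y i j k t a b‖) (𝓝[>] 0) (𝓝 0) ∨
      Tendsto (fun t => ‖y i j k t a b‖) (𝓝[>] 0) (𝓝 1) := by
    intro i j k a b
    refine tendsto_zero_or_one_of_sub_cube ?_ (fun t => norm_nonneg _) ?_
    · exact ((continuous_id.matrix_elem a b).comp_continuousOn (hyc i j k)).norm
    · rw [tendsto_iff_ultrafilter]
      intro U hU
      obtain ⟨γ', hγ', hγ'tr, hγ'y⟩ := hlim U hU
      have h1 := (Matrix.tendsto_apply (hγ'y i j k) a b).norm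
      have h2 := h1.sub (h1.pow 3)
      obtain ⟨κ'', -, h3⟩ := exists_injective_norm_eq_ite γ' hγ' N
        fun i j => (hγ'tr i j).trans (hN i j)
      have h4 : ‖γ' (MatSum.single i j k) a b‖ - ‖γ' (MatSum.single i j k) a b‖ ^ 3 = 0 := by
        by_cases h5 : γ' (MatSum.single i j k) a b = 0
        · simp [h5]
        · simp [(h3 i j k a b).2 h5]
      rw [h4] at h2
      exact h2
  have hpat : ∀ i j k a b, Tendsto (fun t => ‖y i j k t (σ a) (σ b)‖) (𝓝[>] 0)
      (𝓝 ‖β (MatSum.single i j k) a b‖) := by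
    intro i j k a b
    have h1 : ‖γ (MatSum.single i j k) (σ a) (σ b)‖ = ‖β (MatSum.single i j k) a b‖ := by
      have h2 : γ (MatSum.single i j k) (σ a) (σ b) ≠ 0 ↔ β (MatSum.single i j k) a b ≠ 0 := by
        rw [(hκγ i j k _ _).1, (hκβ i j k _ _).1]
        refine exists_congr fun r => ?_
        rw [← hσ, ← hσ, σ.injective.eq_iff, σ.injective.eq_iff]
      by_cases h3 : β (MatSum.single i j k) a b = 0
      · rw [h3, not_not.1 (mt h2.1 (not_not.2 h3))]
      · rw [(hκβ i j k a b).2 h3, (hκγ i j k _ _).2 (h2.2 h3)]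
    have h2 := (Matrix.tendsto_apply (hγy i j k) (σ a) (σ b)).norm
    rw [← h1]
    rcases hdich i j k (σ a) (σ b) with h | h
    · rwa [tendsto_nhds_unique h2 (h.mono_left hU₀)]
    · rwa [tendsto_nhds_unique h2 (h.mono_left hU₀)]
  have hdiag : ∀ i j a, β (MatSum.single i j j) a a ≠ 0 →
      Tendsto (fun t => y i j j t (σ a) (σ a)) (𝓝[>] 0) (𝓝 1) := by
    intro i j a ha
    rw [tendsto_iff_ultrafilter]
    intro U hU
    obtain ⟨γ', hγ', -, hγ'y⟩ := hlim U hU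
    have h1 := Matrix.tendsto_apply (hγ'y i j j) (σ a) (σ a)
    have h2 := tendsto_nhds_unique h1.norm ((hpat i j j a a).mono_left hU)
    rw [(hκβ i j j a a).2 ha] at h2
    rw [apply_single_eq_one (hγ' i j j) (fun h => by simp [h] at h2)] at h1
    exact h1
  -- The base index `0`; the argument `j` only witnesses that the block is nonempty.
  let o : ∀ i, Fin (d i) → Fin (d i) := fun i j => ⟨0, j.pos⟩
  have hoo : ∀ i j k, o i j = o i k := fun i j k => rfl
  -- The phase by which the lifted matrix unit from the base point to `κ x` differs from that of
  -- `β`; points outside the range of `κ` need no correction and get `1`.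
  let Φ : X → ℝ → ℂ := Function.extend κ
    (fun x t => y x.1 (o x.1 x.2.2) x.2.2 t (σ (κ ⟨x.1, x.2.1, o x.1 x.2.2⟩)) (σ (κ x)) *
      star (β (MatSum.single x.1 (o x.1 x.2.2) x.2.2) (κ ⟨x.1, x.2.1, o x.1 x.2.2⟩) (κ x)))
    (fun _ _ => 1)
  have hΦ : ∀ x t, Φ (κ x) t = y x.1 (o x.1 x.2.2) x.2.2 t (σ (κ ⟨x.1, x.2.1, o x.1 x.2.2⟩))
      (σ (κ x)) * star (β (MatSum.single x.1 (o x.1 x.2.2) x.2.2)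
        (κ ⟨x.1, x.2.1, o x.1 x.2.2⟩) (κ x)) := fun x t => by
    simp only [Φ, hκ.extend_apply]
  have hΦ1 : ∀ a, (¬∃ x, κ x = a) → Φ a = fun _ => 1 := fun a ha => by
    simp only [Φ, Function.extend_apply' _ _ _ ha]
  have hZ : ∀ x : Σ i, Fin (N i) × Fin (d i), ‖β (MatSum.single x.1 (o x.1 x.2.2) x.2.2)
      (κ ⟨x.1, x.2.1, o x.1 x.2.2⟩) (κ x)‖ = 1 := fun x =>
    (hκβ _ _ _ _ _).2 ((hκβ _ _ _ _ _).1.2 ⟨x.2.1, rfl, rfl⟩)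
  have hΦn : ∀ x t, ‖Φ (κ x) t‖ = ‖y x.1 (o x.1 x.2.2) x.2.2 t
      (σ (κ ⟨x.1, x.2.1, o x.1 x.2.2⟩)) (σ (κ x))‖ := fun x t => by
    rw [hΦ, norm_mul, norm_star, hZ, mul_one]
  have hΦc : ∀ a, ContinuousOn (Φ a) (Set.Ioo 0 1) := by
    intro a
    by_cases ha : ∃ x, κ x = a
    · obtain ⟨x, rfl⟩ := ha
      have h1 : Φ (κ x) = fun t => _ := funext (hΦ x)
      rw [h1]
      exact ((continuous_id.matrix_elem _ _).comp_continuousOn (hyc _ _ _)).mul continuousOn_const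
    · rw [hΦ1 a ha]
      exact continuousOn_const
  have hΦ0 : ∀ a, ∀ᶠ t in 𝓝[>] (0 : ℝ), Φ a t ≠ 0 := by
    intro a
    by_cases ha : ∃ x, κ x = a
    · obtain ⟨x, rfl⟩ := ha
      have h1 := hpat x.1 (o x.1 x.2.2) x.2.2 (κ ⟨x.1, x.2.1, o x.1 x.2.2⟩) (κ x)
      rw [hZ] at h1
      filter_upwards [h1.eventually_const_lt zero_lt_one] with t ht
      rw [← norm_ne_zero_iff, hΦn]
      exact ht.ne'
    · rw [hΦ1 a ha]
      exact Eventually.of_forall fun _ => one_ne_zero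
  obtain ⟨c, hcc, hcn, hc1, hct⟩ := exists_phases Φ hΦc hΦ0
  refine ⟨σ, c, hcc, hcn, hc1, ?_⟩
  set V : ℝ → Matrix X X ℂ := fun t => Matrix.diagonal (c t) * σ.permMatrix ℂ * u t with hV
  have hC : ∀ t ∈ Set.Ioo (0 : ℝ) 1,
      star (Matrix.diagonal (c t) * σ.permMatrix ℂ) * (Matrix.diagonal (c t) * σ.permMatrix ℂ)
        = 1 := by
    intro t ht
    have h1 : star (Matrix.diagonal (c t)) * Matrix.diagonal (c t) = 1 := by
      rw [Matrix.star_eq_conjTranspose, Matrix.diagonal_conjTranspose,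
        Matrix.diagonal_mul_diagonal, ← Matrix.diagonal_one]
      congr 1
      funext a
      rw [Pi.star_apply, Complex.star_def, Complex.conj_mul', hcn t ht]
      simp
    rw [star_mul, mul_assoc, ← mul_assoc (star (Matrix.diagonal (c t))), h1, one_mul,
      Matrix.star_permMatrix_mul_self]
  have hVu : ∀ t ∈ Set.Ioo (0 : ℝ) 1, star (V t) * V t = 1 := by
    intro t ht
    simp only [V]
    rw [star_mul, mul_assoc, ← mul_assoc (star (Matrix.diagonal (c t) * σ.permMatrix ℂ)), hC t ht,
      one_mul, hu t ht]
  have hzero : ∀ i j k a b, β (MatSum.single i j k) a b = 0 →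
      Tendsto (fun t => c t a * y i j k t (σ a) (σ b) * star (c t b)) (𝓝[>] 0) (𝓝 0) := by
    intro i j k a b h
    have h1 := hpat i j k a b
    rw [h, norm_zero] at h1
    refine squeeze_zero_norm' ?_ h1
    filter_upwards [hIoo] with t ht
    rw [norm_mul, norm_mul, norm_star, hcn t ht, hcn t ht, one_mul, mul_one]
  have hbase : ∀ i j, Tendsto (fun t => V t * β' (MatSum.single i (o i j) j) * star (V t)) (𝓝[>] 0)
      (𝓝 (β (MatSum.single i (o i j) j))) := by
    intro i j
    have h1 : Tendsto (fun t => (Matrix.diagonal (c t) * σ.permMatrix ℂ) * y i (o i j) j t *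
        star (Matrix.diagonal (c t) * σ.permMatrix ℂ)) (𝓝[>] 0)
        (𝓝 (β (MatSum.single i (o i j) j))) := by
      refine Matrix.tendsto_of_apply fun a b => ?_
      have h2 : ∀ t, ((Matrix.diagonal (c t) * σ.permMatrix ℂ) * y i (o i j) j t *
          star (Matrix.diagonal (c t) * σ.permMatrix ℂ)) a b
          = c t a * y i (o i j) j t (σ a) (σ b) * star (c t b) := by
        intro t
        have h3 : (Matrix.diagonal (c t) * σ.permMatrix ℂ) * y i (o i j) j t *
            star (Matrix.diagonal (c t) * σ.permMatrix ℂ)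
            = Matrix.diagonal (c t) * (σ.permMatrix ℂ * y i (o i j) j t * star (σ.permMatrix ℂ)) *
              Matrix.diagonal (star (c t)) := by
          rw [star_mul, Matrix.star_eq_conjTranspose (Matrix.diagonal (c t)),
            Matrix.diagonal_conjTranspose]
          simp only [Matrix.mul_assoc]
        rw [h3, Matrix.mul_diagonal, Matrix.diagonal_mul, Matrix.perm_conj_apply]
        rfl
      simp only [h2]
      by_cases h : β (MatSum.single i (o i j) j) a b = 0
      · rw [h]
        exact hzero _ _ _ _ _ h
      · obtain ⟨r, rfl, rfl⟩ := (hκβ _ _ _ _ _).1.1 h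
        have ha : β (MatSum.single i (o i j) (o i j)) (κ ⟨i, r, o i j⟩) (κ ⟨i, r, o i j⟩) ≠ 0 :=
          (hκβ _ _ _ _ _).1.2 ⟨r, rfl, rfl⟩
        have hca : Tendsto (fun t => c t (κ ⟨i, r, o i j⟩)) (𝓝[>] 0) (𝓝 1) := by
          have e1 : Tendsto (Φ (κ ⟨i, r, o i j⟩)) (𝓝[>] 0) (𝓝 1) := by
            have e2 := (hdiag i (o i j) _ ha).mul_const
              (star (β (MatSum.single i (o i j) (o i j)) (κ ⟨i, r, o i j⟩) (κ ⟨i, r, o i j⟩)))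
            rw [apply_single_eq_one (hβ _ _ _) ha, star_one, mul_one] at e2
            refine e2.congr fun t => ?_
            rw [hΦ]
            simp only
            rw [← hoo i j (o i j), apply_single_eq_one (hβ _ _ _) ha, star_one]
          have e2 : Tendsto (fun t => Φ (κ ⟨i, r, o i j⟩) t / ‖Φ (κ ⟨i, r, o i j⟩) t‖) (𝓝[>] 0)
              (𝓝 1) := by
            have := e1.div ((Complex.continuous_ofReal.tendsto _).comp e1.norm) (by simp)
            simp only [norm_one, Complex.ofReal_one, div_one] at this
            exact this
          have e3 := (hct (κ ⟨i, r, o i j⟩)).mul e2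
          rw [one_mul] at e3
          refine e3.congr' ?_
          filter_upwards [hΦ0 (κ ⟨i, r, o i j⟩)] with t ht
          have : Φ (κ ⟨i, r, o i j⟩) t / ‖Φ (κ ⟨i, r, o i j⟩) t‖ ≠ 0 :=
            div_ne_zero ht (by exact_mod_cast norm_ne_zero_iff.2 ht)
          rw [mul_assoc, inv_mul_cancel₀ this, mul_one]
        have hZ1 := hZ ⟨i, r, j⟩
        have hΦx := hΦ ⟨i, r, j⟩
        have hΦnx := hΦn ⟨i, r, j⟩
        simp only at hZ1 hΦx hΦnx
        have hy1 := hpat i (o i j) j (κ ⟨i, r, o i j⟩) (κ ⟨i, r, j⟩)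
        rw [hZ1] at hy1
        -- With `Y` the entry of `y` and `Z` that of `β`, the factor at the base point tends to `1`
        -- and the one at `κ x` cancels the phase of `Y * star Z`, leaving `|Y| Z → Z`.
        have e4 := ((hca.mul (hct (κ ⟨i, r, j⟩)).star).mul
          ((Complex.continuous_ofReal.tendsto _).comp hy1)).mul_const
          (β (MatSum.single i (o i j) j) (κ ⟨i, r, o i j⟩) (κ ⟨i, r, j⟩))
        simp only [star_one, mul_one, Complex.ofReal_one, one_mul] at e4
        refine e4.congr' ?_
        filter_upwards [hΦ0 (κ ⟨i, r, j⟩)] with t ht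
        rw [hΦnx, hΦx]
        rw [hΦx] at ht
        have hY := left_ne_zero_of_mul ht
        simp only [Function.comp_apply]
        generalize hYdef : y i (o i j) j t (σ (κ ⟨i, r, o i j⟩)) (σ (κ ⟨i, r, j⟩)) = Y at *
        generalize hZdef : β (MatSum.single i (o i j) j) (κ ⟨i, r, o i j⟩) (κ ⟨i, r, j⟩) = Z at *
        have hY2 : (‖Y‖ : ℂ) ^ 2 = star Y * Y := by rw [Complex.star_def, Complex.conj_mul']
        have hn : (‖Y‖ : ℂ) ≠ 0 := by exact_mod_cast norm_ne_zero_iff.2 hY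
        have hsY : star Y ≠ 0 := star_ne_zero.2 hY
        have hsn : star (‖Y‖ : ℂ) = ‖Y‖ := Complex.conj_ofReal _
        simp only [star_mul', star_inv₀, star_div₀, star_star, hsn]
        field_simp
        rw [hY2]
        ring
    have h2 : Tendsto (fun t => (Matrix.diagonal (c t) * σ.permMatrix ℂ) *
        (y i (o i j) j t - u t * β' (MatSum.single i (o i j) j) * star (u t)) *
        star (Matrix.diagonal (c t) * σ.permMatrix ℂ)) (𝓝[>] 0) (𝓝 0) := by
      refine squeeze_zero_norm' ?_ (tendsto_zero_iff_norm_tendsto_zero.1 (hy i (o i j) j))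
      filter_upwards [hIoo] with t ht
      exact Matrix.norm_conj_le (hC t ht) _
    have h3 := h1.sub h2
    rw [sub_zero] at h3
    refine h3.congr fun t => ?_
    simp only [V, star_mul]
    noncomm_ring
  have hunit : ∀ i j k, Tendsto (fun t => V t * β' (MatSum.single i j k) * star (V t)) (𝓝[>] 0)
      (𝓝 (β (MatSum.single i j k))) := by
    intro i j k
    -- Matrix units out of the base index generate the others, so the base case suffices.
    have h1 : MatSum.single i j k = star (MatSum.single i (o i j) j) * MatSum.single i (o i k) k := by
      rw [MatSum.star_single, hoo i k j, MatSum.single_mul_single]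
    have h2 := (hbase i j).star.mul (hbase i k)
    rw [h1, map_mul β, map_star β]
    refine h2.congr' ?_
    filter_upwards [hIoo] with t ht
    rw [map_mul, map_star]
    simp only [star_mul, star_star]
    have h3 := hVu t ht
    calc V t * (star (β' (MatSum.single i (o i j) j)) * star (V t)) *
          (V t * β' (MatSum.single i (o i k) k) * star (V t))
        = V t * star (β' (MatSum.single i (o i j) j)) * (star (V t) * V t) *
          β' (MatSum.single i (o i k) k) * star (V t) := by simp only [mul_assoc]
      _ = _ := by rw [h3, mul_one]; simp only [mul_assoc]
  intro x
  have h1 : ∀ t, V t * β' x * star (V t) = ∑ i, ∑ j, ∑ k, x i j k •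
      (V t * β' (MatSum.single i j k) * star (V t)) := by
    intro t
    conv_lhs => rw [MatSum.eq_sum_single x]
    simp only [map_sum, map_smul, Finset.mul_sum, Finset.sum_mul, mul_smul_comm, smul_mul_assoc]
  have h2 : β x = ∑ i, ∑ j, ∑ k, x i j k • β (MatSum.single i j k) := by
    conv_lhs => rw [MatSum.eq_sum_single x]
    simp only [map_sum, map_smul]
  rw [funext h1, h2]
  exact tendsto_finsetSum _ fun i _ => tendsto_finsetSum _ fun j _ => tendsto_finsetSum _ fun k _ =>
    (hunit i j k).const_smul _

end EndPoint

/-! ### End-point correction in direct sums -/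

section EndMatSum

variable {I P : Type*} [Fintype P] {d : I → ℕ} {n : P → ℕ}

theorem MatSum.norm_conj_le {v : MatSum n} (hv : star v * v = 1) (x : MatSum n) :
    ‖v * x * star v‖ ≤ ‖x‖ :=
  (pi_norm_le_iff_of_nonneg (norm_nonneg _)).2 fun p =>
    (Matrix.norm_conj_le (congrFun hv p) (x p)).trans (norm_le_pi_norm x p)

theorem MatSum.mul_star_self_of_star_mul_self {v : MatSum n} (hv : star v * v = 1) :
    v * star v = 1 := funext fun p => mul_eq_one_comm.1 (congrFun hv p)

theorem MatSum.tendsto_conj {α : Type*} {l : Filter α} {v x : α → MatSum n} {y z : MatSum n}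
    (hv : ∀ᶠ t in l, star (v t) * v t = 1) (hx : Tendsto x l (𝓝 y))
    (hy : Tendsto (fun t => v t * y * star (v t)) l (𝓝 z)) :
    Tendsto (fun t => v t * x t * star (v t)) l (𝓝 z) := by
  have h1 : Tendsto (fun t => v t * (x t - y) * star (v t)) l (𝓝 0) := by
    refine squeeze_zero_norm' (hv.mono fun t ht => MatSum.norm_conj_le ht _)
      (tendsto_zero_iff_norm_tendsto_zero.1 ?_)
    simpa using hx.sub_const y
  have h2 := h1.add hy
  rw [zero_add] at h2
  refine h2.congr fun t => ?_
  rw [mul_sub, sub_mul, sub_add_cancel]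

/-- The permutation matrix in a direct sum of matrix algebras. -/
noncomputable def permMat (σ : ∀ p, Equiv.Perm (Fin (n p))) : MatSum n :=
  fun p => (σ p).permMatrix ℂ

theorem star_permMat_mul_self (σ : ∀ p, Equiv.Perm (Fin (n p))) :
    star (permMat σ) * permMat σ = 1 := funext fun p => Matrix.star_permMatrix_mul_self (σ p)

theorem permMat_mul_star_self (σ : ∀ p, Equiv.Perm (Fin (n p))) :
    permMat σ * star (permMat σ) = 1 :=
  MatSum.mul_star_self_of_star_mul_self (star_permMat_mul_self σ)

/-- The end-point correction is applied in each block of `E` to `β` and `β ∘ Ad(w*)`. Phases trivial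
on `[1/2, 1)` allow the corrections at both ends to be combined. -/
theorem exists_diag_path_tendsto [Fintype I] [DecidableEq I] (β : MatSum d →⋆ₙₐ[ℂ] MatSum n)
    (hβ : IsStandardHom β) {w : MatSum d} (hw : w * star w = 1)
    (u : ℝ → MatSum n) (huc : ContinuousOn u (Set.Ioo 0 1))
    (hu : ∀ t ∈ Set.Ioo (0 : ℝ) 1, star (u t) * u t = 1)
    (x : ∀ i, Fin (d i) → Fin (d i) → ℝ → MatSum n)
    (hxc : ∀ i j k, ContinuousOn (x i j k) (Set.Ioo 0 1))
    (hxm : ∀ i j k, ∀ t ∈ Set.Ioo (0 : ℝ) 1, ∀ p, ((u t * x i j k t * star (u t)) p).IsMonomial)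
    (hx : ∀ i j k, Tendsto (x i j k) (𝓝[>] 0) (𝓝 (β (star w * MatSum.single i j k * w)))) :
    ∃ (σ : ∀ p, Equiv.Perm (Fin (n p))) (c : ℝ → MatSum n), ContinuousOn c (Set.Ioo 0 1) ∧
      (∀ t ∈ Set.Ioo (0 : ℝ) 1, star (c t) * c t = 1) ∧ (∀ t, 1 / 2 ≤ t → c t = 1) ∧
      (∀ t p, (c t p).IsDiag) ∧
      ∀ a, Tendsto (fun t => (c t * permMat σ * u t) * β (star w * a * w) *
        star (c t * permMat σ * u t)) (𝓝[>] 0) (𝓝 (β a)) := by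
  have hIoo : Set.Ioo (0 : ℝ) 1 ∈ 𝓝[>] (0 : ℝ) := Ioo_mem_nhdsGT one_pos
  let proj : ∀ p, MatSum n →⋆ₙₐ[ℂ] Matrix (Fin (n p)) (Fin (n p)) ℂ := fun p =>
    { toFun := fun x => x p
      map_smul' := fun _ _ => rfl
      map_zero' := rfl
      map_add' := fun _ _ => rfl
      map_mul' := fun _ _ => rfl
      map_star' := fun _ => rfl }
  let adw : MatSum d →⋆ₙₐ[ℂ] MatSum d :=
    { toFun := fun a => star w * a * w
      map_smul' := fun _ _ => by simp
      map_zero' := by simp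
      map_add' := fun _ _ => by rw [mul_add, add_mul]
      map_mul' := fun a b => by
        calc star w * (a * b) * w = star w * a * 1 * b * w := by simp only [mul_assoc, mul_one]
          _ = star w * a * w * (star w * b * w) := by rw [← hw]; simp only [mul_assoc]
      map_star' := fun a => by simp only [star_mul, star_star, mul_assoc] }
  have H : ∀ p, ∃ (σ : Equiv.Perm (Fin (n p))) (c : ℝ → Fin (n p) → ℂ),
      (∀ a, ContinuousOn (fun t => c t a) (Set.Ioo 0 1)) ∧
      (∀ t ∈ Set.Ioo (0 : ℝ) 1, ∀ a, ‖c t a‖ = 1) ∧ (∀ t, 1 / 2 ≤ t → ∀ a, c t a = 1) ∧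
      ∀ a, Tendsto (fun t => (Matrix.diagonal (c t) * σ.permMatrix ℂ * u t p) *
        β (star w * a * w) p * star (Matrix.diagonal (c t) * σ.permMatrix ℂ * u t p)) (𝓝[>] 0)
        (𝓝 (β a p)) := by
    intro p
    refine exists_perm_phases_tendsto ((proj p).comp β) ((proj p).comp (β.comp adw))
      (fun i j k => hβ.isMonomial p i j k) (fun i j => ?_) (fun t => u t p)
      (fun t ht => congrFun (hu t ht) p) (fun i j k t => (u t * x i j k t * star (u t)) p)
      (fun i j k => ?_) (fun i j k t ht => hxm i j k t ht p) (fun i j k => ?_)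
    -- The traces agree because `w* e · e w` and `e w · w* e = e` have the same trace under `β`.
    · have e1 : adw (MatSum.single i j j) = (star w * MatSum.single i j j) *
          (MatSum.single i j j * w) := by
        calc adw (MatSum.single i j j)
            = star w * (MatSum.single i j j * MatSum.single i j j) * w := by
              rw [MatSum.single_mul_single]; rfl
          _ = _ := by simp only [mul_assoc]
      have e2 : MatSum.single i j j = (MatSum.single i j j * w) * (star w * MatSum.single i j j) := by
        conv_lhs => rw [← MatSum.single_mul_single i j j j]
        rw [mul_assoc, ← mul_assoc w, hw, one_mul]
      change (((proj p).comp β) (adw (MatSum.single i j j))).trace = _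
      rw [e1, map_mul, Matrix.trace_mul_comm, ← map_mul, ← e2]
    · exact (continuous_apply p).comp_continuousOn ((huc.mul (hxc i j k)).mul huc.star)
    · have h1 : Tendsto (fun t => u t * (x i j k t - β (star w * MatSum.single i j k * w)) *
          star (u t)) (𝓝[>] 0) (𝓝 0) := by
        refine squeeze_zero_norm' (mem_of_superset hIoo fun t ht => MatSum.norm_conj_le (hu t ht) _)
          (tendsto_zero_iff_norm_tendsto_zero.1 ?_)
        simpa using (hx i j k).sub_const (β (star w * MatSum.single i j k * w))
      have h2 := ((continuous_apply p).tendsto _).comp h1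
      refine h2.congr fun t => ?_
      simp only [Function.comp_apply, mul_sub, sub_mul]
      rfl
  choose σ c hcc hcn hc1 hct using H
  refine ⟨σ, fun t p => Matrix.diagonal (c p t), ?_, ?_, ?_, fun t p => Matrix.isDiag_diagonal _,
    fun a => tendsto_pi_nhds.2 fun p => hct p a⟩
  · refine continuousOn_pi.2 fun p => ?_
    have : ContinuousOn (c p) (Set.Ioo 0 1) := continuousOn_pi.2 (hcc p)
    exact continuous_id.matrix_diagonal.comp_continuousOn this
  · intro t ht
    funext p
    change star (Matrix.diagonal (c p t)) * Matrix.diagonal (c p t) = 1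
    rw [Matrix.star_eq_conjTranspose, Matrix.diagonal_conjTranspose,
      Matrix.diagonal_mul_diagonal, ← Matrix.diagonal_one]
    congr 1
    funext a
    rw [Pi.star_apply, Complex.star_def, Complex.conj_mul', hcn p t ht]
    simp
  · intro t ht
    funext p
    change Matrix.diagonal (c p t) = 1
    rw [show c p t = 1 from funext (hc1 p t ht)]
    exact Matrix.diagonal_one

end EndMatSum

/-! ### Conjugation isomorphisms of NCCW complexes -/

section Nccw

variable {I P : Type*} [Fintype I] [Fintype P] {d : I → ℕ} {n : P → ℕ}
  {β₀ β₁ β₀' β₁' : MatSum d →⋆ₙₐ[ℂ] MatSum n}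

/-- Evaluation of the elements of an NCCW complex at a point of the real line, which is first
projected to the unit interval. -/
noncomputable def nccwEval (β₀ β₁ : MatSum d →⋆ₙₐ[ℂ] MatSum n) (t : ℝ) :
    nccw β₀ β₁ →⋆ₙₐ[ℂ] MatSum n where
  toFun x := x.1.1 (Set.projIcc 0 1 zero_le_one t)
  map_smul' _ _ := rfl
  map_zero' := rfl
  map_add' _ _ := rfl
  map_mul' _ _ := rfl
  map_star' _ := rfl

/-- The projection of an NCCW complex to its finite-dimensional summand. -/
noncomputable def nccwSnd (β₀ β₁ : MatSum d →⋆ₙₐ[ℂ] MatSum n) :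
    nccw β₀ β₁ →⋆ₙₐ[ℂ] MatSum d where
  toFun x := x.1.2
  map_smul' _ _ := rfl
  map_zero' := rfl
  map_add' _ _ := rfl
  map_mul' _ _ := rfl
  map_star' _ := rfl

theorem continuous_nccwEval (x : nccw β₀ β₁) : Continuous fun t => nccwEval β₀ β₁ t x :=
  x.1.1.continuous.comp continuous_projIcc

theorem nccwEval_coe (x : nccw β₀ β₁) (t : unitInterval) : nccwEval β₀ β₁ t x = x.1.1 t := by
  change x.1.1 (Set.projIcc 0 1 zero_le_one t) = _
  rw [Set.projIcc_val]

theorem nccwEval_zero (x : nccw β₀ β₁) : nccwEval β₀ β₁ 0 x = β₀ (nccwSnd β₀ β₁ x) :=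
  (nccwEval_coe x 0).trans x.2.1

theorem nccwEval_one (x : nccw β₀ β₁) : nccwEval β₀ β₁ 1 x = β₁ (nccwSnd β₀ β₁ x) :=
  (nccwEval_coe x 1).trans x.2.2

theorem nccwSnd_mul (x y : nccw β₀ β₁) :
    nccwSnd β₀ β₁ (x * y) = nccwSnd β₀ β₁ x * nccwSnd β₀ β₁ y := rfl

theorem nccwSnd_add (x y : nccw β₀ β₁) :
    nccwSnd β₀ β₁ (x + y) = nccwSnd β₀ β₁ x + nccwSnd β₀ β₁ y := rfl

theorem nccwSnd_star (x : nccw β₀ β₁) : nccwSnd β₀ β₁ (star x) = star (nccwSnd β₀ β₁ x) := rfl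

set_option synthInstance.maxHeartbeats 400000 in
theorem nccwSnd_smul (r : ℂ) (x : nccw β₀ β₁) : nccwSnd β₀ β₁ (r • x) = r • nccwSnd β₀ β₁ x := rfl

theorem nccwEval_mul (t : ℝ) (x y : nccw β₀ β₁) :
    nccwEval β₀ β₁ t (x * y) = nccwEval β₀ β₁ t x * nccwEval β₀ β₁ t y := rfl

theorem nccwEval_add (t : ℝ) (x y : nccw β₀ β₁) :
    nccwEval β₀ β₁ t (x + y) = nccwEval β₀ β₁ t x + nccwEval β₀ β₁ t y := rfl

theorem nccwEval_star (t : ℝ) (x : nccw β₀ β₁) : nccwEval β₀ β₁ t (star x) = star (nccwEval β₀ β₁ t x) := rfl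

set_option synthInstance.maxHeartbeats 400000 in
theorem nccwEval_smul (t : ℝ) (r : ℂ) (x : nccw β₀ β₁) : nccwEval β₀ β₁ t (r • x) = r • nccwEval β₀ β₁ t x := rfl

theorem nccw_ext {x y : nccw β₀ β₁} (h : nccwSnd β₀ β₁ x = nccwSnd β₀ β₁ y)
    (h' : ∀ t ∈ Set.Ioo (0 : ℝ) 1, nccwEval β₀ β₁ t x = nccwEval β₀ β₁ t y) : x = y := by
  refine Subtype.ext (Prod.ext (ContinuousMap.ext fun t => ?_) h)
  rw [← nccwEval_coe, ← nccwEval_coe]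
  have h1 : closure (Set.Ioo (0 : ℝ) 1) ⊆ {t | nccwEval β₀ β₁ t x = nccwEval β₀ β₁ t y} :=
    closure_minimal h' (isClosed_eq (continuous_nccwEval x) (continuous_nccwEval y))
  rw [closure_Ioo zero_ne_one] at h1
  exact h1 t.2

theorem nccwEval_surjective {t : ℝ} (ht : t ∈ Set.Ioo (0 : ℝ) 1) :
    Function.Surjective (nccwEval β₀ β₁ t) := by
  intro M
  -- A tent with value `1` at `t` and `0` at both end points, so the finite-dimensional component
  -- may be `0`.
  let f : C(unitInterval, MatSum n) :=
    ⟨fun s => ((min (s / t) ((1 - s) / (1 - t)) : ℝ) : ℂ) • M, by fun_prop⟩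
  refine ⟨⟨(f, 0), ?_, ?_⟩, ?_⟩
  · have : min 0 (1 - t)⁻¹ = 0 := min_eq_left (inv_nonneg.2 (by linarith [ht.2]))
    simp [f, this]
  · have : min t⁻¹ 0 = 0 := min_eq_right (inv_nonneg.2 ht.1.le)
    simp [f, this]
  · change f (Set.projIcc 0 1 zero_le_one t) = M
    have h1 : 1 - t ≠ 0 := by linarith [ht.2]
    rw [Set.projIcc_of_mem zero_le_one ⟨ht.1.le, ht.2.le⟩]
    simp [f, div_self ht.1.ne', div_self h1]

theorem nccwSnd_surjective : Function.Surjective (nccwSnd β₀ β₁) := by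
  intro a
  let f : C(unitInterval, MatSum n) :=
    ⟨fun s => ((1 - s : ℝ) : ℂ) • β₀ a + ((s : ℝ) : ℂ) • β₁ a, by fun_prop⟩
  exact ⟨⟨(f, a), by simp [f], by simp [f]⟩, rfl⟩

/-- A path of unitaries on the open interval with the right asymptotic behaviour at the end points
acts on NCCW complexes by pointwise conjugation. -/
theorem exists_nccw_conj {V : ℝ → MatSum n} (hVc : ContinuousOn V (Set.Ioo 0 1))
    (hV : ∀ t ∈ Set.Ioo (0 : ℝ) 1, star (V t) * V t = 1) {w : MatSum d}
    (h₀ : ∀ a, Tendsto (fun t => V t * β₀ a * star (V t)) (𝓝[>] 0) (𝓝 (β₀' (w * a * star w))))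
    (h₁ : ∀ a, Tendsto (fun t => V t * β₁ a * star (V t)) (𝓝[<] 1) (𝓝 (β₁' (w * a * star w))))
    (x : nccw β₀ β₁) : ∃ y : nccw β₀' β₁', nccwSnd β₀' β₁' y = w * nccwSnd β₀ β₁ x * star w ∧
      ∀ t ∈ Set.Ioo (0 : ℝ) 1,
        nccwEval β₀' β₁' t y = V t * nccwEval β₀ β₁ t x * star (V t) := by
  let g : ℝ → MatSum n := fun t => V t * nccwEval β₀ β₁ t x * star (V t)
  have hg : ContinuousOn g (Set.Ioo 0 1) :=
    (hVc.mul (continuous_nccwEval x).continuousOn).mul hVc.star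
  have hx : ∀ (t : ℝ) (s : Set ℝ), Tendsto (fun r => nccwEval β₀ β₁ r x) (𝓝[s] t)
      (𝓝 (nccwEval β₀ β₁ t x)) := fun t s =>
    ((continuous_nccwEval x).tendsto t).mono_left nhdsWithin_le_nhds
  have hg0 : Tendsto g (𝓝[>] 0) (𝓝 (β₀' (w * nccwSnd β₀ β₁ x * star w))) :=
    MatSum.tendsto_conj (mem_of_superset (Ioo_mem_nhdsGT one_pos) hV)
      (by rw [← nccwEval_zero]; exact hx 0 _) (h₀ _)
  have hg1 : Tendsto g (𝓝[<] 1) (𝓝 (β₁' (w * nccwSnd β₀ β₁ x * star w))) :=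
    MatSum.tendsto_conj (mem_of_superset (Ioo_mem_nhdsLT one_pos) hV)
      (by rw [← nccwEval_one]; exact hx 1 _) (h₁ _)
  -- The path `V` itself may diverge at the end points; only the conjugated function has limits
  -- there.
  have hG := continuousOn_Icc_extendFrom_Ioo hg hg0 hg1
  let f : C(unitInterval, MatSum n) :=
    ⟨fun t => extendFrom (Set.Ioo 0 1) g t, hG.domRestrict⟩
  refine ⟨⟨(f, w * nccwSnd β₀ β₁ x * star w), ?_, ?_⟩, rfl, fun t ht => ?_⟩
  · exact eq_lim_at_left_extendFrom_Ioo zero_lt_one hg0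
  · exact eq_lim_at_right_extendFrom_Ioo zero_lt_one hg1
  · change f (Set.projIcc 0 1 zero_le_one t) = g t
    rw [Set.projIcc_of_mem zero_le_one ⟨ht.1.le, ht.2.le⟩]
    exact extendFrom_eq (subset_closure ht) (hg t ht)

/-- A map of NCCW complexes given by pointwise conjugation with a path of unitaries. -/
structure IsNccwConj (V : ℝ → MatSum n) (w : MatSum d) (φ : nccw β₀ β₁ → nccw β₀' β₁') : Prop where
  star_mul_path : ∀ t ∈ Set.Ioo (0 : ℝ) 1, star (V t) * V t = 1
  star_mul_fin : star w * w = 1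
  snd : ∀ x, nccwSnd β₀' β₁' (φ x) = w * nccwSnd β₀ β₁ x * star w
  eval : ∀ x, ∀ t ∈ Set.Ioo (0 : ℝ) 1,
    nccwEval β₀' β₁' t (φ x) = V t * nccwEval β₀ β₁ t x * star (V t)

theorem conj_mul_of_star_mul_self {R : Type*} [Monoid R] [StarMul R] {v : R} (hv : star v * v = 1)
    (x y : R) : v * (x * y) * star v = (v * x * star v) * (v * y * star v) := by
  calc v * (x * y) * star v = v * x * 1 * y * star v := by simp only [mul_assoc, mul_one]
    _ = _ := by rw [← hv]; simp only [mul_assoc]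

theorem star_mul_conj_mul {R : Type*} [Monoid R] [StarMul R] {v : R} (hv : star v * v = 1)
    (y : R) : star v * (v * y * star v) * v = y := by
  calc star v * (v * y * star v) * v = (star v * v) * y * (star v * v) := by
        simp only [mul_assoc]
    _ = y := by rw [hv, one_mul, mul_one]

section IsNccwConj

variable {V : ℝ → MatSum n} {w : MatSum d} {φ : nccw β₀ β₁ → nccw β₀' β₁'}

theorem IsNccwConj.map_mul (h : IsNccwConj V w φ) (x y : nccw β₀ β₁) :
    φ (x * y) = φ x * φ y := by
  refine nccw_ext ?_ fun t ht => ?_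
  · rw [nccwSnd_mul, h.snd, h.snd, h.snd, nccwSnd_mul, conj_mul_of_star_mul_self h.star_mul_fin]
  · rw [nccwEval_mul, h.eval _ t ht, h.eval _ t ht, h.eval _ t ht, nccwEval_mul,
      conj_mul_of_star_mul_self (h.star_mul_path t ht)]

theorem IsNccwConj.map_add (h : IsNccwConj V w φ) (x y : nccw β₀ β₁) :
    φ (x + y) = φ x + φ y := by
  refine nccw_ext ?_ fun t ht => ?_
  · rw [nccwSnd_add, h.snd, h.snd, h.snd, nccwSnd_add, mul_add, add_mul]
  · rw [nccwEval_add, h.eval _ t ht, h.eval _ t ht, h.eval _ t ht, nccwEval_add, mul_add, add_mul]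

theorem IsNccwConj.map_star (h : IsNccwConj V w φ) (x : nccw β₀ β₁) :
    φ (star x) = star (φ x) := by
  refine nccw_ext ?_ fun t ht => ?_
  · rw [nccwSnd_star, h.snd, h.snd, nccwSnd_star, star_mul, star_mul, star_star, mul_assoc]
  · rw [nccwEval_star, h.eval _ t ht, h.eval _ t ht, nccwEval_star, star_mul, star_mul, star_star,
      mul_assoc]

set_option synthInstance.maxHeartbeats 400000 in
theorem IsNccwConj.map_smul (h : IsNccwConj V w φ) (r : ℂ) (x : nccw β₀ β₁) :
    φ (r • x) = r • φ x := by
  refine nccw_ext ?_ fun t ht => ?_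
  · rw [nccwSnd_smul, h.snd, h.snd, nccwSnd_smul, mul_smul_comm, smul_mul_assoc]
  · rw [nccwEval_smul, h.eval _ t ht, h.eval _ t ht, nccwEval_smul, mul_smul_comm, smul_mul_assoc]

theorem IsNccwConj.leftInverse (h : IsNccwConj V w φ) {ψ : nccw β₀' β₁' → nccw β₀ β₁}
    (h' : IsNccwConj (fun t => star (V t)) (star w) ψ) : Function.LeftInverse ψ φ := by
  intro x
  refine nccw_ext ?_ fun t ht => ?_
  · rw [h'.snd, h.snd, star_star, star_mul_conj_mul h.star_mul_fin]
  · rw [h'.eval _ t ht, h.eval _ t ht, star_star, star_mul_conj_mul (h.star_mul_path t ht)]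

end IsNccwConj

/-- The isomorphism of NCCW complexes given by pointwise conjugation with a path of unitaries. -/
theorem exists_isNccwConj {V : ℝ → MatSum n} (hVc : ContinuousOn V (Set.Ioo 0 1))
    (hV : ∀ t ∈ Set.Ioo (0 : ℝ) 1, star (V t) * V t = 1) {w : MatSum d}
    (hw : star w * w = 1)
    (h₀ : ∀ a, Tendsto (fun t => V t * β₀ a * star (V t)) (𝓝[>] 0) (𝓝 (β₀' (w * a * star w))))
    (h₁ : ∀ a, Tendsto (fun t => V t * β₁ a * star (V t)) (𝓝[<] 1) (𝓝 (β₁' (w * a * star w)))) :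
    ∃ (φ : nccw β₀ β₁ → nccw β₀' β₁') (ψ : nccw β₀' β₁' → nccw β₀ β₁),
      IsNccwConj V w φ ∧ Function.LeftInverse ψ φ ∧ Function.RightInverse ψ φ := by
  have hw' : w * star w = 1 := MatSum.mul_star_self_of_star_mul_self hw
  have hV' : ∀ t ∈ Set.Ioo (0 : ℝ) 1, V t * star (V t) = 1 := fun t ht =>
    MatSum.mul_star_self_of_star_mul_self (hV t ht)
  -- Conjugation by unitaries is contractive, so the asymptotic relation can be inverted although
  -- `V` has no limit.
  have hinv : ∀ {l : Filter ℝ} {γ γ' : MatSum d →⋆ₙₐ[ℂ] MatSum n}, Set.Ioo (0 : ℝ) 1 ∈ l →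
      (∀ a, Tendsto (fun t => V t * γ a * star (V t)) l (𝓝 (γ' (w * a * star w)))) →
      ∀ a, Tendsto (fun t => star (V t) * γ' a * star (star (V t))) l
        (𝓝 (γ (star w * a * star (star w)))) := by
    intro l γ γ' hl h a
    have h2 := h (star w * a * w)
    have h3 : w * (star w * a * w) * star w = a := by
      have := star_mul_conj_mul (v := star w) (by rw [star_star]; exact hw') a
      rwa [star_star] at this
    rw [h3] at h2
    have h4 : Tendsto (fun t => star (V t) * (γ' a - V t * γ (star w * a * w) * star (V t)) *
        star (star (V t))) l (𝓝 0) := by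
      refine squeeze_zero_norm' (mem_of_superset hl fun t ht =>
        MatSum.norm_conj_le (by rw [star_star]; exact hV' t ht) _)
        (tendsto_zero_iff_norm_tendsto_zero.1 ?_)
      simpa using h2.const_sub (γ' a)
    have h5 := h4.add_const (γ (star w * a * w))
    rw [zero_add] at h5
    rw [star_star]
    refine h5.congr' ?_
    filter_upwards [hl] with t ht
    rw [star_star, mul_sub, sub_mul, star_mul_conj_mul (hV t ht), sub_add_cancel]
  have H := exists_nccw_conj hVc hV h₀ h₁
  have H' := exists_nccw_conj (V := fun t => star (V t)) (w := star w) (β₀ := β₀') (β₁ := β₁')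
    (β₀' := β₀) (β₁' := β₁) hVc.star
    (fun t ht => by rw [star_star]; exact hV' t ht) (hinv (Ioo_mem_nhdsGT one_pos) h₀)
    (hinv (Ioo_mem_nhdsLT one_pos) h₁)
  choose φ hφ₂ hφ using H
  choose ψ hψ₂ hψ using H'
  have h : IsNccwConj V w φ := ⟨hV, hw, hφ₂, hφ⟩
  have h' : IsNccwConj (fun t => star (V t)) (star w) ψ :=
    ⟨fun t ht => by rw [star_star]; exact hV' t ht, by rw [star_star]; exact hw', hψ₂, hψ⟩
  refine ⟨φ, ψ, h, h.leftInverse h', h'.leftInverse ?_⟩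
  simpa only [star_star] using h

/-- Diagonal matrices commute at each point of the interval; by (A2) the end-point values determine
the component in `F`, which therefore commutes too. -/
theorem nccwDiag_mul_comm (hinj : Function.Injective fun a : MatSum d => (β₀ a, β₁ a))
    {x y : nccw β₀ β₁} (hx : x ∈ nccwDiag β₀ β₁) (hy : y ∈ nccwDiag β₀ β₁) : x * y = y * x := by
  have h1 : ∀ t : ℝ, nccwEval β₀ β₁ t (x * y) = nccwEval β₀ β₁ t (y * x) := by
    intro t
    rw [nccwEval_mul, nccwEval_mul]
    funext p
    have hx' : (nccwEval β₀ β₁ t x p).IsDiag := hx _ p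
    have hy' : (nccwEval β₀ β₁ t y p).IsDiag := hy _ p
    rw [Pi.mul_apply, Pi.mul_apply, ← hx'.diagonal_diag, ← hy'.diagonal_diag,
      Matrix.diagonal_mul_diagonal, Matrix.diagonal_mul_diagonal]
    congr 1
    funext a
    exact mul_comm _ _
  refine nccw_ext (hinj (Prod.ext ?_ ?_)) fun t _ => h1 t
  · simp only [← nccwEval_zero, h1]
  · simp only [← nccwEval_one, h1]

end Nccw

/-! ### The permutation and the isomorphism -/

section Final

variable {I P : Type*} [Fintype I] [Fintype P] {d : I → ℕ} {n : P → ℕ}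

omit [Fintype P] in
theorem permMat_mul_star (σ τ : ∀ p, Equiv.Perm (Fin (n p))) :
    permMat σ * star (permMat τ) = permMat fun p => (τ p)⁻¹ * σ p := by
  funext p
  simp only [permMat, Pi.mul_apply, Pi.star_apply, Matrix.star_eq_conjTranspose,
    Matrix.conjTranspose_permMatrix, Matrix.permMatrix_mul]

omit [Fintype P] in
theorem isDiag_permMat_conj (σ : ∀ p, Equiv.Perm (Fin (n p))) {x : MatSum n}
    (hx : ∀ p, (x p).IsDiag) (p : P) : ((permMat σ * x * star (permMat σ)) p).IsDiag := by
  intro a b hab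
  change ((σ p).permMatrix ℂ * x p * star ((σ p).permMatrix ℂ)) a b = 0
  rw [Matrix.perm_conj_apply]
  exact hx p fun h => hab ((σ p).injective h)

omit [Fintype P] in
theorem isDiag_mul {x y : MatSum n} (hx : ∀ p, (x p).IsDiag) (hy : ∀ p, (y p).IsDiag) (p : P) :
    ((x * y) p).IsDiag := by
  rw [Pi.mul_apply, ← (hx p).diagonal_diag, ← (hy p).diagonal_diag, Matrix.diagonal_mul_diagonal]
  exact Matrix.isDiag_diagonal _

theorem mem_nccwDiag_of_eval {β₀ β₁ : MatSum d →⋆ₙₐ[ℂ] MatSum n} {x : nccw β₀ β₁}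
    (h : ∀ t ∈ Set.Ioo (0 : ℝ) 1, ∀ p, (nccwEval β₀ β₁ t x p).IsDiag) : x ∈ nccwDiag β₀ β₁ := by
  intro t p a b hab
  have hc : Continuous fun t => nccwEval β₀ β₁ t x p a b :=
    ((continuous_apply p).comp (continuous_nccwEval x)).matrix_elem a b
  have h1 : closure (Set.Ioo (0 : ℝ) 1) ⊆ {t | nccwEval β₀ β₁ t x p a b = 0} :=
    closure_minimal (fun t ht => h t ht p hab) (isClosed_eq hc continuous_const)
  rw [closure_Ioo zero_ne_one] at h1
  have h2 : nccwEval β₀ β₁ t x p a b = 0 := h1 t.2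
  rwa [nccwEval_coe] at h2

/-- Every C*-diagonal of an NCCW complex is conjugated into the pointwise diagonal elements of a
twisted NCCW complex. -/
theorem exists_isNccwConj_diag [DecidableEq I] (β₀ β₁ : MatSum d →⋆ₙₐ[ℂ] MatSum n)
    (hβ₀ : IsStandardHom β₀) (hβ₁ : IsStandardHom β₁)
    (B : NonUnitalStarSubalgebra ℂ (nccw β₀ β₁)) (hB : IsCStarDiagonal (A := nccw β₀ β₁) B) :
    ∃ σ : unitary (MatSum n), IsPermMatrix (σ : MatSum n) ∧
      ∃ (V : ℝ → MatSum n) (w : MatSum d) (φ : nccw β₀ β₁ → nccw β₀ (adComp σ β₁))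
        (ψ : nccw β₀ (adComp σ β₁) → nccw β₀ β₁),
        IsNccwConj V w φ ∧ Function.LeftInverse ψ φ ∧ Function.RightInverse ψ φ ∧
          ∀ b ∈ B, φ b ∈ nccwDiag β₀ (adComp σ β₁) := by
  obtain ⟨w, hw⟩ := hB.exists_diagonalizes (π := nccwSnd β₀ β₁) nccwSnd_surjective
  obtain ⟨u, huc, hu⟩ := hB.exists_continuousOn_Ioo_diagonalizes (nccwEval β₀ β₁)
    continuous_nccwEval (fun t ht => nccwEval_surjective ht)
  choose x hxN hx using fun i j k =>
    hB.exists_normalizer (π := nccwSnd β₀ β₁) nccwSnd_surjective hw i j k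
  have hxs : ∀ i j k, nccwSnd β₀ β₁ (x i j k) = star w * MatSum.single i j k * w := by
    intro i j k
    rw [MatSum.single, ← hx, star_mul_conj_mul hw.star_mul_self]
  have hflip : ∀ t ∈ Set.Ioo (0 : ℝ) 1, 1 - t ∈ Set.Ioo (0 : ℝ) 1 := fun t ht =>
    ⟨by linarith [ht.2], by linarith [ht.1]⟩
  have hflipc : ContinuousOn (fun t : ℝ => 1 - t) (Set.Ioo 0 1) := by fun_prop
  have hlim : ∀ (y : nccw β₀ β₁) (f : ℝ → ℝ) (l : Filter ℝ) (r : ℝ), Tendsto f l (𝓝 r) →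
      Tendsto (fun t => nccwEval β₀ β₁ (f t) y) l (𝓝 (nccwEval β₀ β₁ r y)) := fun y f l r h =>
    ((continuous_nccwEval y).tendsto r).comp h
  obtain ⟨σ₀, c₀, hc₀c, hc₀u, hc₀1, hc₀D, hc₀⟩ := exists_diag_path_tendsto β₀ hβ₀ hw.mul_star_self u
    huc (fun t ht => (hu t ht).star_mul_self) (fun i j k t => nccwEval β₀ β₁ t (x i j k))
    (fun i j k => (continuous_nccwEval _).continuousOn)
    (fun i j k t ht p => (hu t ht).isMonomial (hxN i j k) p) (fun i j k => by
      rw [← hxs, ← nccwEval_zero]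
      exact hlim _ (fun t => t) _ _ nhdsWithin_le_nhds)
  obtain ⟨σ₁, c₁, hc₁c, hc₁u, hc₁1, hc₁D, hc₁⟩ := exists_diag_path_tendsto β₁ hβ₁ hw.mul_star_self
    (fun t => u (1 - t)) (huc.comp hflipc hflip)
    (fun t ht => (hu _ (hflip t ht)).star_mul_self)
    (fun i j k t => nccwEval β₀ β₁ (1 - t) (x i j k))
    (fun i j k => (continuous_nccwEval _).comp_continuousOn hflipc)
    (fun i j k t ht p => (hu _ (hflip t ht)).isMonomial (hxN i j k) p) (fun i j k => by
      rw [← hxs, ← nccwEval_one]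
      refine hlim _ (fun t => 1 - t) _ _ ?_
      have : Tendsto (fun t : ℝ => 1 - t) (𝓝 0) (𝓝 (1 - 0)) := by
        exact (continuous_const.sub continuous_id).tendsto 0
      rw [sub_zero] at this
      exact this.mono_left nhdsWithin_le_nhds)
  -- As matrices `τ = σ₀ σ₁*`; the order reverses because `permMatrix` is antimultiplicative.
  set τ : ∀ p, Equiv.Perm (Fin (n p)) := fun p => (σ₁ p)⁻¹ * σ₀ p with hτ
  have hτ₁ : permMat τ * permMat σ₁ = permMat σ₀ := by
    rw [hτ, ← permMat_mul_star, mul_assoc, star_permMat_mul_self, mul_one]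
  have hτ₂ : star (permMat τ) * permMat σ₀ = permMat σ₁ := by
    rw [← hτ₁, ← mul_assoc, star_permMat_mul_self, one_mul]
  let T : unitary (MatSum n) := ⟨permMat τ, star_permMat_mul_self τ, permMat_mul_star_self τ⟩
  -- On `(0, 1/2)` the second factor is trivial and `V = c₀ σ₀ u`; on `(1/2, 1)` the first is
  -- trivial and `V = τ c₁(1 - t) σ₁ u`, which leaves the twist by `τ` at the end point `1`.
  let c : ℝ → MatSum n := fun t => c₀ t * (permMat τ * c₁ (1 - t) * star (permMat τ))
  let V : ℝ → MatSum n := fun t => c t * permMat σ₀ * u t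
  have hcD : ∀ t p, (c t p).IsDiag := fun t =>
    isDiag_mul (hc₀D t) (isDiag_permMat_conj τ (hc₁D _))
  have hVc : ContinuousOn V (Set.Ioo 0 1) :=
    ((hc₀c.mul ((continuousOn_const.mul (hc₁c.comp hflipc hflip)).mul continuousOn_const)).mul
      continuousOn_const).mul huc
  have hmul : ∀ {v z : MatSum n}, star v * v = 1 → star z * z = 1 → star (v * z) * (v * z) = 1 := by
    intro v z hv hz
    rw [star_mul, mul_assoc, ← mul_assoc (star v), hv, one_mul, hz]
  have hV : ∀ t ∈ Set.Ioo (0 : ℝ) 1, star (V t) * V t = 1 := fun t ht =>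
    hmul (hmul (hmul (hc₀u t ht) (hmul (hmul (star_permMat_mul_self τ) (hc₁u _ (hflip t ht)))
      (by rw [star_star, permMat_mul_star_self]))) (star_permMat_mul_self σ₀))
      (hu t ht).star_mul_self
  have h₀ : ∀ a, Tendsto (fun t => V t * β₀ a * star (V t)) (𝓝[>] 0)
      (𝓝 (β₀ (w * a * star w))) := by
    intro a
    have h1 := hc₀ (w * a * star w)
    rw [star_mul_conj_mul hw.star_mul_self] at h1
    refine h1.congr' ?_
    filter_upwards [Ioo_mem_nhdsGT (show (0 : ℝ) < 1 / 2 by norm_num)] with t ht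
    have h2 : V t = c₀ t * permMat σ₀ * u t := by
      simp only [V, c]
      rw [hc₁1 (1 - t) (by linarith [ht.2]), mul_one, permMat_mul_star_self, mul_one]
    rw [h2]
  have h₁ : ∀ a, Tendsto (fun t => V t * β₁ a * star (V t)) (𝓝[<] 1)
      (𝓝 (adComp T β₁ (w * a * star w))) := by
    intro a
    have hl : Tendsto (fun t : ℝ => 1 - t) (𝓝[<] 1) (𝓝[>] 0) := by
      refine tendsto_nhdsWithin_iff.2 ⟨?_, ?_⟩
      · have : Tendsto (fun t : ℝ => 1 - t) (𝓝 1) (𝓝 (1 - 1)) :=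
          (continuous_const.sub continuous_id).tendsto 1
        rw [sub_self] at this
        exact this.mono_left nhdsWithin_le_nhds
      · filter_upwards [self_mem_nhdsWithin] with t ht
        exact sub_pos.2 (Set.mem_Iio.1 ht)
    have h1 := (hc₁ (w * a * star w)).comp hl
    rw [star_mul_conj_mul hw.star_mul_self] at h1
    have h3 : Tendsto _ (𝓝[<] (1 : ℝ)) (𝓝 (permMat τ * β₁ (w * a * star w) * star (permMat τ))) :=
      (h1.const_mul (permMat τ)).mul_const (star (permMat τ))
    refine h3.congr' ?_
    filter_upwards [Ioo_mem_nhdsLT (show (1 / 2 : ℝ) < 1 by norm_num)] with t ht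
    have h2 : V t = permMat τ * (c₁ (1 - t) * permMat σ₁ * u t) := by
      simp only [V, c]
      rw [hc₀1 t ht.1.le, one_mul, ← hτ₂]
      simp only [mul_assoc]
    simp only [Function.comp_apply, sub_sub_cancel]
    rw [h2]
    simp only [star_mul, mul_assoc]
  obtain ⟨φ, ψ, hφ, hl, hr⟩ := exists_isNccwConj hVc hV hw.star_mul_self h₀ h₁
  refine ⟨T, fun p => ⟨τ p, rfl⟩, V, w, φ, ψ, hφ, hl, hr, fun b hb => ?_⟩
  refine mem_nccwDiag_of_eval fun t ht => ?_
  rw [hφ.eval b t ht]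
  have h2 : V t * nccwEval β₀ β₁ t b * star (V t) = c t * (permMat σ₀ *
      (u t * nccwEval β₀ β₁ t b * star (u t)) * star (permMat σ₀)) * star (c t) := by
    simp only [V, star_mul, mul_assoc]
  rw [h2]
  exact isDiag_mul (isDiag_mul (hcD t) (isDiag_permMat_conj σ₀ ((hu t ht).isDiag b hb)))
    fun p => (hcD t p).conjTranspose

theorem adComp_pair_injective {β₀ β₁ : MatSum d →⋆ₙₐ[ℂ] MatSum n}
    (hinj : Function.Injective fun a : MatSum d => (β₀ a, β₁ a)) (σ : unitary (MatSum n)) :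
    Function.Injective fun a : MatSum d => (β₀ a, adComp σ β₁ a) := by
  intro a b hab
  refine hinj (Prod.ext (Prod.ext_iff.1 hab).1 ?_)
  exact (Unitary.conjStarAlgAut ℂ (MatSum n) σ).injective (Prod.ext_iff.1 hab).2

set_option synthInstance.maxHeartbeats 1000000 in
set_option maxHeartbeats 2000000 in
theorem IsNccwConj.exists_starAlgEquiv {β₀ β₁ β₀' β₁' : MatSum d →⋆ₙₐ[ℂ] MatSum n}
    {V : ℝ → MatSum n} {w : MatSum d} {φ : nccw β₀ β₁ → nccw β₀' β₁'}
    {ψ : nccw β₀' β₁' → nccw β₀ β₁} (h : IsNccwConj V w φ) (hl : Function.LeftInverse ψ φ)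
    (hr : Function.RightInverse ψ φ) :
    ∃ e : nccw β₀ β₁ ≃⋆ₐ[ℂ] nccw β₀' β₁', ∀ x, e x = φ x :=
  ⟨{ toFun := φ, invFun := ψ, left_inv := hl, right_inv := hr, map_mul' := h.map_mul,
     map_add' := h.map_add, map_star' := h.map_star, map_smul' := h.map_smul }, fun _ => rfl⟩

end Final

theorem proposition2p2 {I P : Type*} [Fintype I] [DecidableEq I] [Fintype P]
    (d : I → ℕ) (n : P → ℕ) (β₀ β₁ : MatSum d →⋆ₙₐ[ℂ] MatSum n)
    (hβ₀ : IsStandardHom β₀) (hβ₁ : IsStandardHom β₁)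
    (hinj : Function.Injective fun a : MatSum d => (β₀ a, β₁ a))
    (B : NonUnitalStarSubalgebra ℂ (nccw β₀ β₁)) (hB : IsCStarDiagonal (A := nccw β₀ β₁) B) :
    ∃ σ : unitary (MatSum n), IsPermMatrix (σ : MatSum n) ∧
      ∃ φ : nccw β₀ β₁ ≃⋆ₐ[ℂ] nccw β₀ (adComp σ β₁),
        ∀ x, φ x ∈ nccwDiag β₀ (adComp σ β₁) ↔ x ∈ B := by
  obtain ⟨σ, hσ, V, w, φ, ψ, hφ, hl, hr, hφB⟩ := exists_isNccwConj_diag β₀ β₁ hβ₀ hβ₁ B hB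
  obtain ⟨e, he⟩ := hφ.exists_starAlgEquiv hl hr
  refine ⟨σ, hσ, e, fun x => ?_⟩
  rw [he]
  -- An `x` with diagonal image commutes with `B`, as its image commutes with the image of `B`;
  -- maximality puts it in `B`.
  refine ⟨fun hx => hB.maximal x fun b hb => hl.injective ?_, hφB x⟩
  rw [hφ.map_mul, hφ.map_mul]
  exact nccwDiag_mul_comm (adComp_pair_injective hinj σ) hx (hφB b hb)
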